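/- **Setting.** Let $S,d\ge 0$ and $T\ge 1$ be integers. Tokens lie in $\mathsf X=\{0,\dots,K-1\}$, $K\ge1$, with mask token $m=K-1$, identified with one-hot vectors of $\mathbb R^K$; $\mathsf Y=\mathbb R^d$ and $\mathsf Z=\mathsf X^S\times\mathsf Y$. Let $q_0$ be a probability distribution on $\mathsf X^S$. Schedules: $\gamma_t\in[0,1]$, $\alpha_t\ge0$, $\sigma_t>0$ for $1\le t\le T$; put $\bar\gamma_t=\prod_{s\le t}\gamma_s$, $\bar\alpha_t=\prod_{s\le t}\alpha_s$, $\bar\sigma_0^2=0$, $\bar\sigma_t^2=\alpha_t^2\bar\sigma_{t-1}^2+\sigma_t^2$, and assume $\bar\gamma_T=0$. *Forward process $q$.* $X_0\sim q_0$; $Y_0\mid X_0\sim \mathrm N(\mu_\varphi(X_0),\sigma_{\rm lat}^2\mathrm I_d)$ with $\sigma_{\rm lat}>0$ (density $\mathcal E_\varphi$); given $(X_0,Y_0)$ the two channels are independent Markov chains: each token independently stays equal to $m$ once masked and otherwise is kept with probability $\gamma_t$ and masked with probability $1-\gamma_t$; and $Y_t=\alpha_tY_{t-1}+\sigma_t\varepsilon_t$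 with i.i.d. $\varepsilon_t\sim\mathrm N(0,\mathrm I_d)$. Write $Z_t=(X_t,Y_t)$. *Generative process $p^\theta$.* Let $x_\theta(z,t)$ be a measurable family of $S$ probability vectors $x^i_\theta(z,t)$ on $\mathsf X$ with zero mask coordinate, and $y_\theta(z,t)\in\mathsf Y$ measurable in $z$. Put $$p^\theta(z_{0:T})=\mathbf 1[x_T=(m,\dots,m)]\,\mathrm N(y_T;0,\bar\sigma_T^2\mathrm I_d)\prod_{t=1}^T p^{\mathsf X}_{t-1|t}(x_{t-1}|z_t)\,p^{\mathsf Y}_{t-1|t}(y_{t-1}|z_t),$$ where $p^{\mathsf X}_{t-1|t}(\cdot|z_t)$ is the product over positions of the distributions equal to $x_t^i$ if $x_t^i\ne m$ and to $\frac{(1-\bar\gamma_{t-1})m+(\bar\gamma_{t-1}-\bar\gamma_t)x^i_\theta(z_t,t)}{1-\bar\gamma_t}$ if $x_t^i=m$; for $t\ge2$, $p^{\mathsf Y}_{t-1|t}(\cdot|z_t)$ is Gaussian with mean $\frac{\alpha_t\bar\sigma_{t-1}^2}{\bar\sigma_t^2}y_t+\frac{\bar\alpha_{t-1}\sigma_t^2}{\bar\sigma_t^2}y_\theta(z_t,t)$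 and covariance $\frac{\bar\sigma_{t-1}^2\sigma_t^2}{\bar\sigma_t^2}\mathrm I_d$; and $p^{\mathsf Y}_{0|1}(\cdot|z_1)=\mathrm N(y_\theta(z_1,1),\sigma_{\rm lat}^2\mathrm I_d)$. Let $p_0^\theta(x_0)$ be the marginal probability of $x_0$. **Statement.** All quantities below take values in $(-\infty,\infty]$, with $0\cdot\infty=0$, $0/0=0$ and $\log 0=-\infty$. Set $$\mathcal L=\mathrm L^{\mathsf X}_T+\mathrm L^{\mathsf Y}_T+\mathrm L^{\mathsf X}_0+\mathrm L^{\mathsf Z}_0+\sum_{t=2}^T\mathbb E\big[\lambda^{\mathsf X}_t\log\langle x_\theta(Z_t,t),X_0\rangle\big]+\mathbb E\big[\lambda^{\mathsf Y}_t\|Y_0-y_\theta(Z_t,t)\|^2\big],$$ $$\lambda^{\mathsf X}_t=\frac{\bar\gamma_t-\bar\gamma_{t-1}}{1-\bar\gamma_t},\qquad \lambda^{\mathsf Y}_t=\frac{\bar\alpha_{t-1}^2\sigma_t^2}{2\bar\sigma_{t-1}^2\bar\sigma_t^2},$$ where $\log\langle x_\theta(Z_t,t),X_0\rangle=\sum_{i=1}^S\log\langle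 x_\theta^i(Z_t,t),X_0^i\rangle$, $\mathrm L^{\mathsf X}_T=\mathbb E\,\mathrm{KL}(q_{T|0}(\cdot|X_0)\,|\,\delta_{(m,\dots,m)})$, $\mathrm L^{\mathsf Y}_T=\mathbb E\,\mathrm{KL}(q_{T|0}(\cdot|Y_0)\,|\,\mathrm N(0,\bar\sigma_T^2\mathrm I_d))$, $\mathrm L^{\mathsf X}_0=-\mathbb E\log p^{\mathsf X}_{0|1}(X_0|Z_1)$ and $\mathrm L^{\mathsf Z}_0=\mathbb E\|Y_0-y_\theta(Z_1,1)\|^2/(2\sigma_{\rm lat}^2)-d/2$; all expectations are under the forward process. Then $$\mathbb E[-\log p^\theta_0(X_0)]\ \le\ \mathbb E\Big[\log\frac{q(Z_{1:T}|Z_0)\,\mathcal E_\varphi(Y_0|X_0)}{p^\theta(Z_{0:T})}\Big]\ \le\ \mathcal L,$$ and the second inequality (the middle term being the variational negative ELBO) is an equality if $x_\theta$ carries over unmasked tokens, i.e. $x^i_\theta(z,t)=x^i$ for all $1\le t\le T$ and all $z=(x,y)$ and $i$ with $x^i\ne m$. In particular $\mathbb E[-\log p^\theta_0(X_0)]\le\mathcal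 L$. -/

import Mathlib

noncomputable section

namespace FujiLDDM

/-- Tokens: `V` ordinary tokens and one mask token, i.e. a vocabulary of size `K = V + 1`. -/
abbrev Tok (V : ℕ) : Type := Fin (V + 1)

/-- The mask token, the last element of the vocabulary. -/
def mask (V : ℕ) : Tok V := Fin.last V

/-- Token sequences of length `S` (the data channel). -/
abbrev TokSeq (S V : ℕ) : Type := Fin S → Tok V

/-- The latent space `ℝ^d` with its Euclidean norm. -/
abbrev Latent (d : ℕ) : Type := EuclideanSpace ℝ (Fin d)

/-- Joint states `z = (x, y)`. -/
abbrev State (S V d : ℕ) : Type := TokSeq S V × Latent d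

/-- Joint paths `z_{0:T} = (z_0, …, z_T)`. -/
abbrev Path (S V d T : ℕ) : Type := Fin (T + 1) → State S V d

/-- The one-hot vector of a token. -/
def oneHot {V : ℕ} (v : Tok V) : Tok V → ℝ := fun w => if w = v then 1 else 0

/-- The density `N(y; μ, v I_d)` at `y` of the Gaussian law with mean `μ` and covariance `v I_d`. -/
def gaussDensity {d : ℕ} (μ : Latent d) (v : ℝ) (y : Latent d) : ℝ :=
  (2 * Real.pi * v) ^ (-(d : ℝ) / 2) * Real.exp (-‖y - μ‖ ^ 2 / (2 * v))

/-- The Gaussian law with mean `μ` and covariance `v I_d`, for `v > 0`. -/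
def gaussLaw {d : ℕ} (μ : Latent d) (v : ℝ) : MeasureTheory.Measure (Latent d) :=
  MeasureTheory.volume.withDensity fun y => ENNReal.ofReal (gaussDensity μ v y)

/-- One masking step of a single token, with retention probability `g`:
the probability of moving from `x` to `x'`. -/
def tokForward {V : ℕ} (g : ℝ) (x x' : Tok V) : ℝ :=
  if x = mask V then oneHot (mask V) x' else g * oneHot x x' + (1 - g) * oneHot (mask V) x'

/-- The reverse (bridge) transition of a single token from the noisy token `x`, with clean token
distribution `p`; here `gs` and `gt` are the cumulative retention probabilities at times `t - 1`
and `t`. -/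
def tokBridge {V : ℕ} (gs gt : ℝ) (x : Tok V) (p : Tok V → ℝ) (x' : Tok V) : ℝ :=
  if x = mask V then ((1 - gs) * oneHot (mask V) x' + (gs - gt) * p x') / (1 - gt)
  else oneHot x x'

/-- The data of a FUJI latent discrete diffusion model with `S` tokens per sequence, `V` non-mask
tokens, latent dimension `d` and time horizon `T`. -/
structure Model (S V d T : ℕ) where
  /-- the data distribution -/
  data : PMF (TokSeq S V)
  /-- the mean of the Gaussian encoder -/
  encMean : TokSeq S V → Latent d
  /-- the fixed standard deviation of the encoder -/
  sigmaLat : ℝ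
  sigmaLat_pos : 0 < sigmaLat
  /-- the one-step masking schedule `γ_t` -/
  gam : ℕ → ℝ
  gam_mem : ∀ t, 1 ≤ t → t ≤ T → 0 ≤ gam t ∧ gam t ≤ 1
  /-- the chain is fully masked at time `T` -/
  gam_prod : ∏ s ∈ Finset.Icc 1 T, gam s = 0
  /-- the one-step latent schedule `α_t` -/
  alpha : ℕ → ℝ
  alpha_nonneg : ∀ t, 1 ≤ t → t ≤ T → 0 ≤ alpha t
  /-- the one-step latent schedule `σ_t` -/
  sigma : ℕ → ℝ
  sigma_pos : ∀ t, 1 ≤ t → t ≤ T → 0 < sigma t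
  /-- the discrete denoiser: at time `t` and state `z`, a categorical distribution per position -/
  xDen : ℕ → State S V d → Fin S → Tok V → ℝ
  xDen_measurable : ∀ t i v, Measurable fun z => xDen t z i v
  xDen_nonneg : ∀ t z i v, 0 ≤ xDen t z i v
  xDen_sum : ∀ t z i, ∑ v, xDen t z i v = 1
  xDen_mask : ∀ t z i, xDen t z i (mask V) = 0
  /-- the continuous denoiser -/
  yDen : ℕ → State S V d → Latent d
  yDen_measurable : ∀ t, Measurable (yDen t)

namespace Model

variable {S V d T : ℕ} (M : Model S V d T)

/-- `γ̄_t = γ_1 ⋯ γ_t`. -/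
def gamBar (t : ℕ) : ℝ := ∏ s ∈ Finset.Icc 1 t, M.gam s

/-- `ᾱ_t = α_1 ⋯ α_t`. -/
def alphaBar (t : ℕ) : ℝ := ∏ s ∈ Finset.Icc 1 t, M.alpha s

/-- `σ̄_t²`, defined by `σ̄_0² = 0` and `σ̄_t² = α_t² σ̄_{t-1}² + σ_t²`. -/
def sigmaBarSq : ℕ → ℝ
  | 0 => 0
  | t + 1 => M.alpha (t + 1) ^ 2 * sigmaBarSq t + M.sigma (t + 1) ^ 2

/-! ### Forward process -/

/-- One-step forward transition probability `q(x_t | x_{t-1})` of the tokens, from `x` to `x'`. -/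
def xForward (t : ℕ) (x x' : TokSeq S V) : ℝ := ∏ i, tokForward (M.gam t) (x i) (x' i)

/-- One-step forward transition density `q(y_t | y_{t-1})` of the latents, from `y` to `y'`. -/
def yForward (t : ℕ) (y y' : Latent d) : ℝ := gaussDensity (M.alpha t • y) (M.sigma t ^ 2) y'

/-- The encoder density at `y`, given the tokens `x`. -/
def encoder (x : TokSeq S V) (y : Latent d) : ℝ := gaussDensity (M.encMean x) (M.sigmaLat ^ 2) y

/-- The conditional law `q_{t|0}(· | x)` of the tokens at time `t` given the tokens `x` at time `0`,
by iterating the one-step transitions. -/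
def xMarginal : ℕ → TokSeq S V → MeasureTheory.Measure (TokSeq S V)
  | 0, x => MeasureTheory.Measure.dirac x
  | t + 1, x => (xMarginal t x).bind fun x' =>
      MeasureTheory.Measure.count.withDensity fun x'' => ENNReal.ofReal (M.xForward (t + 1) x' x'')

/-- The conditional law `q_{t|0}(· | y)` of the latent at time `t` given the latent `y` at time `0`,
by iterating the one-step transitions. -/
def yMarginal : ℕ → Latent d → MeasureTheory.Measure (Latent d)
  | 0, y => MeasureTheory.Measure.dirac y
  | t + 1, y => (yMarginal t y).bind fun y' => gaussLaw (M.alpha (t + 1) • y') (M.sigma (t + 1) ^ 2)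

/-- The reference measure on paths: at every time, counting measure on tokens times Lebesgue
measure on latents. -/
def pathRef (S V d T : ℕ) : MeasureTheory.Measure (Path S V d T) :=
  MeasureTheory.Measure.pi fun _ => MeasureTheory.Measure.count.prod MeasureTheory.volume

/-- The law of the forward path `(Z_0, …, Z_T)` given `X_0 = x₀`, with density
`1[X_0 = x₀] E(y_0 | x₀) ∏_t q(x_t | x_{t-1}) q(y_t | y_{t-1})`. -/
def condForwardLaw (x₀ : TokSeq S V) : MeasureTheory.Measure (Path S V d T) :=
  (pathRef S V d T).withDensity fun z => ENNReal.ofReal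
    ((if (z 0).1 = x₀ then 1 else 0) * M.encoder (z 0).1 (z 0).2 *
      ∏ k : Fin T, (M.xForward (k + 1) (z k.castSucc).1 (z k.succ).1 *
        M.yForward (k + 1) (z k.castSucc).2 (z k.succ).2))

/-- The law of the forward path, started from the data distribution. -/
def forwardLaw : MeasureTheory.Measure (Path S V d T) :=
  ∑ x₀, M.data x₀ • M.condForwardLaw x₀

/-! ### Generative process -/

/-- The reverse transition probability of the tokens from the joint state `z` at time `t` to `x'`
at time `t - 1`. -/
def xReverse (t : ℕ) (z : State S V d) (x' : TokSeq S V) : ℝ :=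
  ∏ i, tokBridge (M.gamBar (t - 1)) (M.gamBar t) (z.1 i) (M.xDen t z i) (x' i)

/-- The mean of the Gaussian bridge at time `t - 1` given `y_t` and `y_0`. -/
def bridgeMean (t : ℕ) (yt y0 : Latent d) : Latent d :=
  (M.alpha t * M.sigmaBarSq (t - 1) / M.sigmaBarSq t) • yt +
    (M.alphaBar (t - 1) * M.sigma t ^ 2 / M.sigmaBarSq t) • y0

/-- The variance of the Gaussian bridge at time `t - 1`. -/
def bridgeVar (t : ℕ) : ℝ := M.sigmaBarSq (t - 1) * M.sigma t ^ 2 / M.sigmaBarSq t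

/-- The reverse transition density of the latents from the joint state `z` at time `t` to `y'` at
time `t - 1`: the Gaussian bridge with the clean latent replaced by its prediction if `t ≥ 2`, and
the Gaussian with mean the prediction and variance `σ_lat²` in the last step `t = 1` (where the
bridge would be a Dirac mass). -/
def yReverse (t : ℕ) (z : State S V d) (y' : Latent d) : ℝ :=
  if t = 1 then gaussDensity (M.yDen 1 z) (M.sigmaLat ^ 2) y'
  else gaussDensity (M.bridgeMean t z.2 (M.yDen t z)) (M.bridgeVar t) y'

/-- The law of the generative path, started from all-mask tokens and `N(0, σ̄_T² I_d)`, with density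
`p(x_T) p(y_T) ∏_t p(x_{t-1} | z_t) p(y_{t-1} | z_t)`. -/
def modelLaw : MeasureTheory.Measure (Path S V d T) :=
  (pathRef S V d T).withDensity fun z => ENNReal.ofReal
    ((if (z (Fin.last T)).1 = (fun _ => mask V) then 1 else 0) *
      gaussDensity 0 (M.sigmaBarSq T) (z (Fin.last T)).2 *
      ∏ k : Fin T, (M.xReverse (k + 1) (z k.succ) (z k.castSucc).1 *
        M.yReverse (k + 1) (z k.succ) (z k.castSucc).2))

/-! ### Likelihood, negative ELBO, and the explicit objective -/

/-- The probability that the generated token sequence at time `0` is `x`. -/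
def modelProb (x : TokSeq S V) : ENNReal := M.modelLaw {z | (z 0).1 = x}

/-- The expected negative log-likelihood `E[-log p_0(X_0)]`, in `[0, ∞]`. -/
def negLogLik : EReal := ∑ x, (M.data x : EReal) * -ENNReal.log (M.modelProb x)

/-- The variational negative ELBO
`E[log (q(Z_{1:T}, Y_0 | X_0) / p(Z_{0:T}))]`, written as an averaged Kullback-Leibler divergence
of the forward path law given `X_0` with respect to the generative path law. -/
def negELBO : ENNReal :=
  ∑ x₀, M.data x₀ * InformationTheory.klDiv (M.condForwardLaw x₀) M.modelLaw

/-- The state at time `t ≤ T` of a path. -/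
def at_ (z : Path S V d T) (t : ℕ) : State S V d := z (Fin.ofNat (T + 1) t)

/-- The weight of the cross-entropy term at time `t`; it is nonpositive. -/
def weightX (t : ℕ) : ℝ := (M.gamBar t - M.gamBar (t - 1)) / (1 - M.gamBar t)

/-- The weight of the squared-error term at time `t`. -/
def weightY (t : ℕ) : ℝ :=
  M.alphaBar (t - 1) ^ 2 * M.sigma t ^ 2 / (2 * M.sigmaBarSq (t - 1) * M.sigmaBarSq t)

/-- `⟨x_θ(z, t), x⟩`: the probability that the product of the predicted categorical distributions
gives to the sequence `x`. Its logarithm is the sum over positions of `log ⟨x_θ^i(z, t), x^i⟩`. -/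
def predProb (t : ℕ) (z : State S V d) (x : TokSeq S V) : ℝ := ∏ i, M.xDen t z i (x i)

/-- `L^X_T = E[KL(q_{T|0}(· | X_0) | p_T)]`, with `p_T` the Dirac mass at the all-mask sequence. -/
def lossXT : ENNReal :=
  ∫⁻ z, InformationTheory.klDiv (M.xMarginal T (at_ z 0).1)
    (MeasureTheory.Measure.dirac fun _ => mask V) ∂M.forwardLaw

/-- `L^Y_T = E[KL(q_{T|0}(· | Y_0) | N(0, σ̄_T² I_d))]`. -/
def lossYT : ENNReal :=
  ∫⁻ z, InformationTheory.klDiv (M.yMarginal T (at_ z 0).2) (gaussLaw 0 (M.sigmaBarSq T))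
    ∂M.forwardLaw

/-- `L^X_0 = -E[log p_{0|1}(X_0 | Z_1)]`, the expectation of a `[0, ∞]`-valued variable. -/
def lossX0 : ENNReal :=
  ∫⁻ z, (-ENNReal.log (ENNReal.ofReal (M.xReverse 1 (at_ z 1) (at_ z 0).1))).toENNReal
    ∂M.forwardLaw

/-- `L^Z_0 = E‖Y_0 - y_θ(Z_1)‖² / (2 σ_lat²) - d / 2`. -/
def lossZ0 : EReal :=
  ((∫⁻ z, ENNReal.ofReal (‖(at_ z 0).2 - M.yDen 1 (at_ z 1)‖ ^ 2 / (2 * M.sigmaLat ^ 2))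
    ∂M.forwardLaw : ENNReal) : EReal) - (((d : ℝ) / 2 : ℝ) : EReal)

/-- `E[λ^X_t log ⟨x_θ(Z_t, t), X_0⟩]`. Both factors are nonpositive, so this is the expectation of a
`[0, ∞]`-valued variable (with `0 · ∞ = 0`). -/
def lossX (t : ℕ) : ENNReal :=
  ∫⁻ z, ((M.weightX t : EReal) *
    ENNReal.log (ENNReal.ofReal (M.predProb t (at_ z t) (at_ z 0).1))).toENNReal ∂M.forwardLaw

/-- `E[λ^Y_t ‖Y_0 - y_θ(Z_t, t)‖²]`. -/
def lossY (t : ℕ) : ENNReal :=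
  ∫⁻ z, ENNReal.ofReal (M.weightY t * ‖(at_ z 0).2 - M.yDen t (at_ z t)‖ ^ 2) ∂M.forwardLaw

/-- The explicit objective, with values in `(-∞, ∞]`. -/
def loss : EReal :=
  (M.lossXT : EReal) + (M.lossYT : EReal) + (M.lossX0 : EReal) + M.lossZ0 +
    ∑ t ∈ Finset.Icc 2 T, ((M.lossX t : EReal) + (M.lossY t : EReal))

/-- The discrete denoiser copies the tokens that are already unmasked. -/
def CarryOver : Prop :=
  ∀ t, 1 ≤ t → t ≤ T → ∀ z i, z.1 i ≠ mask V → M.xDen t z i = oneHot (z.1 i)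

end Model

end FujiLDDM

end

/-!
Both path laws have densities for the same reference measure. Given a mask-free `X_0 = x₀`, Bayes'
rule factors the forward density as that of `Z_0`, that of `Z_T` given `Z_0` and the bridges from
`Z_{k+1}` back to `Z_k` given `Z_0`. The generative density has the same shape, with `Z_0` replaced
by its prediction, so the ratio of the generative to the forward density is `exp (N - L)` for
energies `N, L ≥ 0`, and the divergence `D` satisfies `D + E[N] = E[L]`.

A Gaussian factor of either density contributes to `N` or `L` the expectation `d / 2` plus the
weighted squared distance of the two means; all these constants `d / 2` cancel, except the one that
the encoder contributes to `N`. A token unmasked between the times `k + 1` and `k` costs the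
negative log-likelihood of its prediction, and averaging over the bridge produces the weight of the
cross-entropy. The objective also charges the positions that are not masked at time `k + 1`, at no
cost if the denoiser carries them over. If `x₀` contains a mask, both sides are infinite. The bound
on the likelihood is the data processing inequality for the map `z ↦ x_0`.
-/

noncomputable section

namespace FujiLDDM

open InformationTheory MeasureTheory ProbabilityTheory Set
open scoped ENNReal Matrix

/-! ### Exponentials and logarithms with values in `[0, ∞]` -/

section NegLog

/-- `exp (-L)` for a cost `L ∈ [0, ∞]`, equal to `0` at `∞`. Ratios of path densities are written
as quotients of such factors, which keeps every identity free of subtractions. -/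
def expNeg (L : ℝ≥0∞) : ℝ≥0∞ := EReal.exp (-(L : EReal))

/-- `-log p`, as an extended nonnegative number: it is `∞` at `0` and truncated to `0` for
`1 ≤ p`. -/
def negLog (p : ℝ≥0∞) : ℝ≥0∞ := (-ENNReal.log p).toENNReal

@[simp] lemma expNeg_zero : expNeg 0 = 1 := by simp [expNeg]

@[simp] lemma expNeg_top : expNeg ∞ = 0 := by simp [expNeg]

lemma expNeg_ofReal {x : ℝ} (hx : 0 ≤ x) :
    expNeg (ENNReal.ofReal x) = ENNReal.ofReal (Real.exp (-x)) := by
  rw [expNeg, EReal.coe_ennreal_ofReal, max_eq_left hx, ← EReal.coe_neg, EReal.exp_coe]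

lemma expNeg_of_ne_top {L : ℝ≥0∞} (hL : L ≠ ∞) :
    expNeg L = ENNReal.ofReal (Real.exp (-L.toReal)) := by
  rw [← expNeg_ofReal ENNReal.toReal_nonneg, ENNReal.ofReal_toReal hL]

lemma expNeg_add (a b : ℝ≥0∞) : expNeg (a + b) = expNeg a * expNeg b := by
  rw [expNeg, EReal.coe_ennreal_add, EReal.neg_add (by simp) (by simp), sub_eq_add_neg,
    EReal.exp_add, expNeg, expNeg]

lemma expNeg_sum {ι : Type*} (s : Finset ι) (L : ι → ℝ≥0∞) :
    expNeg (∑ i ∈ s, L i) = ∏ i ∈ s, expNeg (L i) := by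
  classical
  induction s using Finset.induction_on with
  | empty => simp
  | insert i s hi ih => rw [Finset.sum_insert hi, Finset.prod_insert hi, expNeg_add, ih]

lemma expNeg_eq_zero_iff {L : ℝ≥0∞} : expNeg L = 0 ↔ L = ∞ := by
  simp [expNeg, EReal.neg_eq_bot_iff]

lemma expNeg_negLog {p : ℝ≥0∞} (hp : p ≤ 1) : expNeg (negLog p) = p := by
  have h : 0 ≤ -ENNReal.log p := by simpa using hp
  rw [expNeg, negLog, EReal.coe_toENNReal h, neg_neg, ENNReal.exp_log]

@[simp] lemma negLog_zero : negLog 0 = ∞ := by simp [negLog]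

@[simp] lemma negLog_one : negLog 1 = 0 := by simp [negLog]

lemma negLog_mul {p q : ℝ≥0∞} (hp : p ≤ 1) (hq : q ≤ 1) :
    negLog (p * q) = negLog p + negLog q := by
  have hp' : 0 ≤ -ENNReal.log p := by simpa using hp
  have hq' : 0 ≤ -ENNReal.log q := by simpa using hq
  have htop {r : ℝ≥0∞} (hr : r ≤ 1) : ENNReal.log r ≠ ⊤ := by
    simpa using (hr.trans_lt ENNReal.one_lt_top).ne
  rw [negLog, ENNReal.log_mul_add, EReal.neg_add (.inr (htop hq)) (.inl (htop hp)),
    sub_eq_add_neg, EReal.toENNReal_add hp' hq', negLog, negLog]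

lemma negLog_prod {ι : Type*} (s : Finset ι) {p : ι → ℝ≥0∞} (hp : ∀ i ∈ s, p i ≤ 1) :
    negLog (∏ i ∈ s, p i) = ∑ i ∈ s, negLog (p i) := by
  classical
  induction s using Finset.induction_on with
  | empty => simp
  | insert i s hi ih =>
    obtain ⟨hpi, hps⟩ := Finset.forall_mem_insert .. |>.1 hp
    rw [Finset.prod_insert hi, Finset.sum_insert hi, negLog_mul hpi (Finset.prod_le_one' hps),
      ih hps]

@[fun_prop]
lemma measurable_negLog : Measurable negLog := by
  unfold negLog; fun_prop

lemma toENNReal_mul_log {w : ℝ} (hw : w ≤ 0) (p : ℝ≥0∞) :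
    ((w : EReal) * ENNReal.log p).toENNReal = ENNReal.ofReal (-w) * negLog p := by
  have h : (w : EReal) * ENNReal.log p = ((-w : ℝ) : EReal) * -ENNReal.log p := by
    rw [EReal.coe_neg, neg_mul_neg]
  rw [h, EReal.toENNReal_mul (by exact_mod_cast neg_nonneg.2 hw), negLog,
    EReal.toENNReal_of_ne_top (EReal.coe_ne_top _), EReal.toReal_coe]

lemma coe_ennreal_sum {ι : Type*} (s : Finset ι) (φ : ι → ℝ≥0∞) :
    ((∑ i ∈ s, φ i : ℝ≥0∞) : EReal) = ∑ i ∈ s, (φ i : EReal) := by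
  classical
  induction s using Finset.induction_on with
  | empty => simp
  | insert i s hi ih => rw [Finset.sum_insert hi, Finset.sum_insert hi, EReal.coe_ennreal_add, ih]

end NegLog

/-! ### Kullback-Leibler divergence of measures with densities -/

section KL

variable {Ω : Type*} [MeasurableSpace Ω]

lemma klDiv_add_lintegral_of_llr {μ ν : Measure Ω} [IsProbabilityMeasure μ]
    [IsProbabilityMeasure ν] (hμν : μ ≪ ν) {L N : Ω → ℝ≥0∞} (hL : Measurable L)
    (hN : Measurable N) (hLtop : ∀ᵐ z ∂μ, L z ≠ ∞) (hNint : ∫⁻ z, N z ∂μ ≠ ∞)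
    (hllr : llr μ ν =ᵐ[μ] fun z => (L z).toReal - (N z).toReal) :
    klDiv μ ν + ∫⁻ z, N z ∂μ = ∫⁻ z, L z ∂μ := by
  have hNi : Integrable (fun z => (N z).toReal) μ :=
    integrable_toReal_of_lintegral_ne_top hN.aemeasurable hNint
  by_cases hLint : ∫⁻ z, L z ∂μ = ∞
  · have hnot : ¬ Integrable (llr μ ν) μ := fun hint => by
      refine ((integrable_toReal_iff hL.aemeasurable hLtop).1 ((hint.add hNi).congr ?_)) hLint
      filter_upwards [hllr] with z hz
      simp [hz]
    rw [klDiv_of_not_integrable hnot, top_add, hLint]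
  · have hLi : Integrable (fun z => (L z).toReal) μ :=
      integrable_toReal_of_lintegral_ne_top hL.aemeasurable hLint
    have hint : Integrable (llr μ ν) μ := (hLi.sub hNi).congr hllr.symm
    have hNtop : ∀ᵐ z ∂μ, N z < ∞ := ae_lt_top hN hNint
    have hval : ∫ z, llr μ ν z ∂μ = (∫⁻ z, L z ∂μ).toReal - (∫⁻ z, N z ∂μ).toReal := by
      rw [integral_congr_ae hllr, integral_sub hLi hNi, integral_toReal hN.aemeasurable hNtop,
        integral_toReal hL.aemeasurable (hLtop.mono fun _ => Ne.lt_top)]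
    have hnonneg := integral_llr_add_sub_measure_univ_nonneg hμν hint
    rw [klDiv_of_ac_of_integrable hμν hint]
    simp only [probReal_univ, add_sub_cancel_right, hval] at hnonneg ⊢
    nth_rw 2 [← ENNReal.ofReal_toReal hNint]
    rw [← ENNReal.ofReal_add hnonneg ENNReal.toReal_nonneg, sub_add_cancel,
      ENNReal.ofReal_toReal hLint]

section Densities

variable {ref : Measure Ω} {f g L N : Ω → ℝ≥0∞}

lemma ae_withDensity_ne_zero (hf : Measurable f) : ∀ᵐ z ∂ref.withDensity f, f z ≠ 0 :=
  (ae_withDensity_iff hf).2 (ae_of_all _ fun _ => id)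

lemma withDensity_eq_withDensity_div (hf : Measurable f) (hg : Measurable g)
    (hgtop : ∫⁻ z, g z ∂ref ≠ ∞) (hfg : ∀ᵐ z ∂ref.withDensity f, g z ≠ 0) :
    ref.withDensity f = (ref.withDensity g).withDensity (f / g) := by
  rw [← withDensity_mul _ hg (hf.div hg)]
  refine withDensity_congr_ae ?_
  filter_upwards [(ae_withDensity_iff hf).1 hfg, ae_lt_top hg hgtop] with z hz hztop
  by_cases hfz : f z = 0
  · simp [hfz]
  · exact (ENNReal.mul_div_cancel (hz hfz) hztop.ne).symm

lemma log_toReal_div_of_mul_expNeg {a b l n : ℝ≥0∞} (ha : a ≠ 0) (ha' : a ≠ ∞) (hl : l ≠ ∞)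
    (hn : n ≠ ∞) (h : b * expNeg n = a * expNeg l) :
    Real.log (a / b).toReal = l.toReal - n.toReal := by
  have hb := congrArg ENNReal.toReal h
  have hapos := ENNReal.toReal_pos ha ha'
  simp only [ENNReal.toReal_mul, expNeg_of_ne_top hl, expNeg_of_ne_top hn,
    ENNReal.toReal_ofReal (Real.exp_pos _).le] at hb
  have hbval : b.toReal = a.toReal * Real.exp (-(l.toReal - n.toReal)) := by
    have hexp := Real.exp_ne_zero (-n.toReal)
    rw [neg_sub, sub_eq_add_neg, add_comm, Real.exp_add, ← mul_right_inj' hexp,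
      mul_comm _ b.toReal, hb, Real.exp_neg n.toReal]
    field_simp
  rw [ENNReal.toReal_div, hbval, div_mul_cancel_left₀ hapos.ne', ← Real.exp_neg, neg_neg,
    Real.log_exp]

lemma not_absolutelyContinuous_of_mul_expNeg (hf : Measurable f) (hg : Measurable g)
    (hNtop : ∀ᵐ z ∂ref.withDensity f, N z ≠ ∞)
    (h : ∀ z, f z ≠ 0 → g z * expNeg (N z) = f z * expNeg (L z))
    (hLtop : ¬ ∀ᵐ z ∂ref.withDensity f, L z ≠ ∞) :
    ¬ ref.withDensity f ≪ ref.withDensity g := by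
  intro hac
  refine hLtop ?_
  filter_upwards [hac.ae_le (ae_withDensity_ne_zero hg), ae_withDensity_ne_zero hf, hNtop]
    with z hgz hfz hNz hLz
  have hzero : g z * expNeg (N z) = 0 := by rw [h z hfz, hLz, expNeg_top, mul_zero]
  exact (mul_ne_zero hgz (expNeg_eq_zero_iff.not.2 hNz)) hzero

/-- Formally, this is the expectation under `f` of `log (f / g) = L - N`. -/
theorem klDiv_withDensity_add_lintegral
    [IsProbabilityMeasure (ref.withDensity f)] [IsProbabilityMeasure (ref.withDensity g)]
    (hf : Measurable f) (hg : Measurable g) (hL : Measurable L) (hN : Measurable N)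
    (hNint : ∫⁻ z, N z ∂ref.withDensity f ≠ ∞)
    (h : ∀ z, f z ≠ 0 → g z * expNeg (N z) = f z * expNeg (L z)) :
    klDiv (ref.withDensity f) (ref.withDensity g) + ∫⁻ z, N z ∂ref.withDensity f =
      ∫⁻ z, L z ∂ref.withDensity f := by
  have hNtop : ∀ᵐ z ∂ref.withDensity f, N z ≠ ∞ := (ae_lt_top hN hNint).mono fun _ => LT.lt.ne
  by_cases hLtop : ∀ᵐ z ∂ref.withDensity f, L z ≠ ∞
  swap
  · rw [klDiv_of_not_ac (not_absolutelyContinuous_of_mul_expNeg hf hg hNtop h hLtop), top_add]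
    by_contra hint
    exact hLtop ((ae_lt_top hL (Ne.symm hint)).mono fun _ => LT.lt.ne)
  have hlintegral {k : Ω → ℝ≥0∞} [IsProbabilityMeasure (ref.withDensity k)] :
      ∫⁻ z, k z ∂ref ≠ ∞ := by
    rw [← setLIntegral_univ, ← withDensity_apply _ MeasurableSet.univ]; simp
  have hg0 : ∀ᵐ z ∂ref.withDensity f, g z ≠ 0 := by
    filter_upwards [hLtop, ae_withDensity_ne_zero hf] with z hLz hfz hgz
    have hzero : f z * expNeg (L z) = 0 := by rw [← h z hfz, hgz, zero_mul]
    exact (mul_ne_zero hfz (expNeg_eq_zero_iff.not.2 hLz)) hzero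
  have hdiv := withDensity_eq_withDensity_div hf hg hlintegral hg0
  have hac : ref.withDensity f ≪ ref.withDensity g :=
    hdiv ▸ withDensity_absolutelyContinuous _ _
  have hrn : (ref.withDensity f).rnDeriv (ref.withDensity g) =ᵐ[ref.withDensity f] f / g := by
    refine hac.ae_eq ?_
    rw [hdiv]
    exact Measure.rnDeriv_withDensity _ (hf.div hg)
  have hftop : ∀ᵐ z ∂ref.withDensity f, f z < ∞ :=
    (withDensity_absolutelyContinuous _ _).ae_le (ae_lt_top hf hlintegral)
  refine klDiv_add_lintegral_of_llr hac hL hN hLtop hNint ?_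
  filter_upwards [hrn, hLtop, hNtop, hftop, ae_withDensity_ne_zero hf] with z hz hLz hNz hfz hfz0
  rw [llr, hz, Pi.div_apply, log_toReal_div_of_mul_expNeg hfz0 hfz.ne hLz hNz (h z hfz0)]

end Densities

variable {A : Type*} [MeasurableSpace A] [MeasurableSingletonClass A]

lemma klDiv_dirac_left (a : A) (ν : Measure A) [IsProbabilityMeasure ν] :
    klDiv (Measure.dirac a) ν = negLog (ν {a}) := by
  by_cases ha : ν {a} = 0
  · have hac : ¬ Measure.dirac a ≪ ν := fun hac => by simpa using hac ha
    rw [klDiv_of_not_ac hac, ha, negLog_zero]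
  have hdirac : Measure.dirac a = ν.withDensity (indicator {a} fun _ => (ν {a})⁻¹) := by
    rw [withDensity_indicator (measurableSet_singleton a), withDensity_const,
      Measure.restrict_singleton, smul_smul, ENNReal.inv_mul_cancel ha (measure_ne_top _ _),
      one_smul]
  have : IsProbabilityMeasure (ν.withDensity (indicator {a} fun _ => (ν {a})⁻¹)) :=
    hdirac ▸ inferInstance
  have : IsProbabilityMeasure (ν.withDensity 1) := by rw [withDensity_one]; infer_instance
  have hkl := klDiv_withDensity_add_lintegral (ref := ν) (f := indicator {a} fun _ => (ν {a})⁻¹)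
    (g := 1) (L := fun _ => negLog (ν {a})) (N := 0)
    (measurable_const.indicator (measurableSet_singleton a)) measurable_one measurable_const
    measurable_zero (by simp) fun z hz => by
      obtain rfl : z = a := by simpa using mem_of_indicator_ne_zero hz
      simp [expNeg_negLog prob_le_one, ENNReal.inv_mul_cancel ha]
  rw [← hdirac] at hkl
  simpa using hkl

lemma negLog_measure_le_klDiv {μ ν : Measure Ω} [IsProbabilityMeasure μ] [IsProbabilityMeasure ν]
    {g : Ω → A} (hg : Measurable g) {a : A} (h : ∀ᵐ z ∂μ, g z = a) :
    negLog (ν {z | g z = a}) ≤ klDiv μ ν := by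
  have hμ : μ.map g = Measure.dirac a := by
    rw [Measure.map_congr (g := fun _ => a) h]; simp
  have : IsProbabilityMeasure (ν.map g) := Measure.isProbabilityMeasure_map hg.aemeasurable
  calc negLog (ν {z | g z = a})
      = negLog (ν.map g {a}) := by rw [Measure.map_apply hg (measurableSet_singleton a)]; rfl
    _ = klDiv (μ.map g) (ν.map g) := by rw [hμ, klDiv_dirac_left]
    _ ≤ klDiv μ ν := klDiv_map_le μ ν hg

end KL

/-! ### Integration over Markov paths -/

section MarkovPath

variable {E : Type*}

/-- The product of the factors `F k (z k) (z (k + 1))` along a path. -/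
def pathProd (F : ℕ → E → E → ℝ≥0∞) (n : ℕ) (z : Fin (n + 1) → E) : ℝ≥0∞ :=
  ∏ k : Fin n, F k (z k.castSucc) (z k.succ)

lemma pathProd_snoc (F : ℕ → E → E → ℝ≥0∞) (n : ℕ) (z : Fin (n + 1) → E) (v : E) :
    pathProd F (n + 1) (Fin.snoc z v : Fin (n + 2) → E) =
      pathProd F n z * F n (z (Fin.last n)) v := by
  simp only [pathProd, Fin.prod_univ_castSucc, Fin.succ_castSucc, Fin.succ_last, Fin.snoc_castSucc,
    Fin.snoc_last, Fin.val_castSucc, Fin.val_last]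

variable [MeasurableSpace E]

lemma measurable_snoc {n : ℕ} (z : Fin (n + 1) → E) :
    Measurable fun v : E => (Fin.snoc z v : Fin (n + 2) → E) := by
  refine measurable_pi_lambda _ fun i => ?_
  induction i using Fin.lastCases with
  | last => simpa only [Fin.snoc_last] using measurable_id'
  | cast i => simp only [Fin.snoc_castSucc, measurable_const]

lemma lintegral_mul_congr {ν : Measure E} {a g h : E → ℝ≥0∞} (H : ∀ z, a z ≠ 0 → g z = h z) :
    ∫⁻ z, a z * g z ∂ν = ∫⁻ z, a z * h z ∂ν := by
  refine lintegral_congr fun z => ?_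
  rcases eq_or_ne (a z) 0 with hz | hz
  · simp [hz]
  · rw [H z hz]

variable {F R : ℕ → E → E → ℝ≥0∞} {a : E → ℝ≥0∞}

lemma measurable_pathProd (hF : ∀ k, Measurable fun p : E × E => F k p.1 p.2) (n : ℕ) :
    Measurable (pathProd F n) := by
  unfold pathProd; fun_prop

lemma lintegral_path_zero (ν : Measure E) (h : E → ℝ≥0∞) :
    ∫⁻ z : Fin 1 → E, h (z 0) ∂(Measure.pi fun _ => ν) = ∫⁻ u, h u ∂ν :=
  (measurePreserving_funUnique ν (Fin 1)).lintegral_comp_emb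
    (MeasurableEquiv.measurableEmbedding _) h

/-- A Markov chain started from the density `a` with one-step transitions `F k`, its multi-step
transitions `Q k` from the initial state, and its bridges: `B k z₀ w` is the law of the state at
time `k` given the initial state `z₀` and the state `w` at time `k + 1`. There is no bridge into
time `0`. -/
structure IsBridge (ν : Measure E) (a : E → ℝ≥0∞) (F Q : ℕ → E → E → ℝ≥0∞)
    (B : ℕ → E → E → E → ℝ≥0∞) (T : ℕ) : Prop where
  measurable_init : Measurable a
  measurable_step : ∀ k, Measurable fun p : E × E => F k p.1 p.2
  measurable_multi : ∀ k, Measurable fun p : E × E => Q k p.1 p.2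
  measurable_bridge : ∀ k, Measurable fun p : E × E × E => B k p.1 p.2.1 p.2.2
  multi_one : ∀ z₀, a z₀ ≠ 0 → ∀ u, Q 1 z₀ u = F 0 z₀ u
  bayes : ∀ k, 1 ≤ k → k < T → ∀ z₀, a z₀ ≠ 0 → ∀ u w,
    Q k z₀ u * F k u w = Q (k + 1) z₀ w * B k z₀ w u
  lintegral_bridge : ∀ k, 1 ≤ k → k < T → ∀ z₀, a z₀ ≠ 0 → ∀ w, Q (k + 1) z₀ w ≠ 0 →
    ∫⁻ u, B k z₀ w u ∂ν = 1

lemma IsBridge.prod_step_eq {ν : Measure E} {Q : ℕ → E → E → ℝ≥0∞}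
    {B : ℕ → E → E → E → ℝ≥0∞} {T n : ℕ} (hb : IsBridge ν a F Q B T) (hn : n < T) {z : ℕ → E}
    (hz : a (z 0) ≠ 0) :
    ∏ k ∈ Finset.range (n + 1), F k (z k) (z (k + 1)) =
      Q (n + 1) (z 0) (z (n + 1)) * ∏ k ∈ Finset.Ico 1 (n + 1), B k (z 0) (z (k + 1)) (z k) := by
  induction n with
  | zero => simp [hb.multi_one _ hz]
  | succ n ih =>
    rw [Finset.prod_range_succ, ih (by omega), mul_right_comm,
      hb.bayes _ (by omega) hn _ hz, Finset.prod_Ico_succ_top (by omega : 1 ≤ n + 1)]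
    ring

variable (ν : Measure E) [SigmaFinite ν]

lemma lintegral_pi_snoc {n : ℕ} {G : (Fin (n + 2) → E) → ℝ≥0∞} (hG : Measurable G) :
    ∫⁻ z, G z ∂(Measure.pi fun _ => ν) =
      ∫⁻ z : Fin (n + 1) → E, ∫⁻ v, G (Fin.snoc z v) ∂ν ∂(Measure.pi fun _ => ν) := by
  have h := (measurePreserving_piFinSuccAbove (fun _ : Fin (n + 2) => ν) (Fin.last _)).symm
  rw [← h.lintegral_comp_emb (MeasurableEquiv.measurableEmbedding _) G,
    lintegral_prod_symm _ (by fun_prop)]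
  refine lintegral_congr fun z => lintegral_congr fun v => congrArg G ?_
  simp [MeasurableEquiv.piFinSuccAbove, Fin.insertNthEquiv]

lemma lintegral_path_succ (ha : Measurable a) (hF : ∀ k, Measurable fun p : E × E => F k p.1 p.2)
    {n : ℕ} {H : (Fin (n + 2) → E) → ℝ≥0∞} (hH : Measurable H) :
    ∫⁻ z, a (z 0) * pathProd F (n + 1) z * H z ∂(Measure.pi fun _ => ν) =
      ∫⁻ z : Fin (n + 1) → E, a (z 0) * pathProd F n z *
        ∫⁻ v, F n (z (Fin.last n)) v * H (Fin.snoc z v) ∂ν ∂(Measure.pi fun _ => ν) := by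
  have hp := measurable_pathProd hF (n + 1)
  rw [lintegral_pi_snoc ν (by fun_prop)]
  refine lintegral_congr fun z => ?_
  have hs := measurable_snoc z
  rw [← lintegral_const_mul _ (by fun_prop)]
  refine lintegral_congr fun v => ?_
  rw [pathProd_snoc F, Fin.snoc_apply_zero]
  ring

lemma lintegral_path_restrict (ha : Measurable a)
    (hF : ∀ k, Measurable fun p : E × E => F k p.1 p.2) {n T : ℕ} (hnT : n ≤ T)
    (hF1 : ∀ k, n ≤ k → k < T → ∀ u, ∫⁻ v, F k u v ∂ν = 1)
    {H : (Fin (n + 1) → E) → ℝ≥0∞} (hH : Measurable H) :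
    ∫⁻ z : Fin (T + 1) → E, a (z 0) * pathProd F T z *
        H (fun j => z (Fin.castLE (by omega) j)) ∂(Measure.pi fun _ => ν) =
      ∫⁻ z : Fin (n + 1) → E, a (z 0) * pathProd F n z * H z ∂(Measure.pi fun _ => ν) := by
  induction T, hnT using Nat.le_induction with
  | base => rfl
  | succ T hnT ih =>
    have hsnoc (z : Fin (T + 1) → E) (v : E) :
        (fun j : Fin (n + 1) => (Fin.snoc z v : Fin (T + 2) → E) (Fin.castLE (by omega) j)) =
          fun j => z (Fin.castLE (by omega) j) := by
      ext1 j
      exact Fin.snoc_castSucc (α := fun _ => E) v z (Fin.castLE (by omega) j)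
    rw [← ih fun k hk hk' => hF1 k hk (by omega), lintegral_path_succ ν ha hF (by fun_prop)]
    refine lintegral_congr fun z => ?_
    simp_rw [hsnoc]
    rw [lintegral_mul_const _ (by fun_prop), hF1 T hnT (by omega), one_mul]

namespace IsBridge

variable {ν} {Q : ℕ → E → E → ℝ≥0∞} {B : ℕ → E → E → E → ℝ≥0∞} {T n : ℕ}

lemma lintegral_multi_step (hb : IsBridge ν a F Q B T) (h1 : 1 ≤ n) (hn : n < T)
    {h : E → E → E → ℝ≥0∞} (hh : Measurable fun p : E × E × E => h p.1 p.2.1 p.2.2) :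
    ∫⁻ z₀, a z₀ * ∫⁻ u, Q n z₀ u * ∫⁻ w, F n u w * h z₀ u w ∂ν ∂ν ∂ν =
      ∫⁻ z₀, a z₀ * ∫⁻ w, Q (n + 1) z₀ w * ∫⁻ u, B n z₀ w u * h z₀ u w ∂ν ∂ν ∂ν := by
  have hF := hb.measurable_step
  have hQ := hb.measurable_multi
  have hB := hb.measurable_bridge
  refine lintegral_mul_congr fun z₀ h0 => ?_
  calc ∫⁻ u, Q n z₀ u * ∫⁻ w, F n u w * h z₀ u w ∂ν ∂ν
      = ∫⁻ u, ∫⁻ w, Q n z₀ u * (F n u w * h z₀ u w) ∂ν ∂ν :=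
        lintegral_congr fun u => (lintegral_const_mul _ (by fun_prop)).symm
    _ = ∫⁻ w, ∫⁻ u, Q n z₀ u * (F n u w * h z₀ u w) ∂ν ∂ν :=
        lintegral_lintegral_swap (by fun_prop)
    _ = ∫⁻ w, ∫⁻ u, Q (n + 1) z₀ w * (B n z₀ w u * h z₀ u w) ∂ν ∂ν := by
        simp_rw [← mul_assoc, hb.bayes n h1 hn z₀ h0]
    _ = ∫⁻ w, Q (n + 1) z₀ w * ∫⁻ u, B n z₀ w u * h z₀ u w ∂ν ∂ν :=
        lintegral_congr fun w => lintegral_const_mul _ (by fun_prop)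

lemma lintegral_path_last (hb : IsBridge ν a F Q B T) (hn : n < T)
    {h : E → E → ℝ≥0∞} (hh : Measurable fun p : E × E => h p.1 p.2) :
    ∫⁻ z : Fin (n + 2) → E, a (z 0) * pathProd F (n + 1) z * h (z 0) (z (Fin.last _))
        ∂(Measure.pi fun _ => ν) =
      ∫⁻ z₀, a z₀ * ∫⁻ w, Q (n + 1) z₀ w * h z₀ w ∂ν ∂ν := by
  have hF := hb.measurable_step
  have hB := hb.measurable_bridge
  induction n generalizing h with
  | zero =>
    rw [lintegral_path_succ ν hb.measurable_init hF (by fun_prop)]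
    simp only [Fin.snoc_apply_zero, Fin.snoc_last, pathProd, Finset.univ_eq_empty,
      Finset.prod_empty, mul_one, Fin.last_zero]
    rw [lintegral_path_zero ν fun u => a u * ∫⁻ v, F 0 u v * h u v ∂ν]
    refine lintegral_mul_congr fun z₀ h0 => ?_
    simp_rw [zero_add, hb.multi_one z₀ h0]
  | succ n ih =>
    rw [lintegral_path_succ ν hb.measurable_init hF (by fun_prop)]
    simp only [Fin.snoc_apply_zero, Fin.snoc_last]
    rw [ih (h := fun z₀ u => ∫⁻ v, F (n + 1) u v * h z₀ v ∂ν) (by omega) (by fun_prop),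
      hb.lintegral_multi_step (by omega) hn (h := fun z₀ _ w => h z₀ w) (by fun_prop)]
    refine lintegral_mul_congr fun z₀ h0 => lintegral_mul_congr fun w hw => ?_
    rw [lintegral_mul_const _ (by fun_prop), hb.lintegral_bridge _ (by omega) hn z₀ h0 w hw,
      one_mul]

lemma lintegral_path_last_two (hb : IsBridge ν a F Q B T) (hn : n + 1 < T)
    {h : E → E → E → ℝ≥0∞} (hh : Measurable fun p : E × E × E => h p.1 p.2.1 p.2.2) :
    ∫⁻ z : Fin (n + 3) → E, a (z 0) * pathProd F (n + 2) z *
        h (z 0) (z (Fin.last _).castSucc) (z (Fin.last _)) ∂(Measure.pi fun _ => ν) =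
      ∫⁻ z₀, a z₀ * ∫⁻ w, Q (n + 2) z₀ w * ∫⁻ u, B (n + 1) z₀ w u * h z₀ u w ∂ν ∂ν ∂ν := by
  have hF := hb.measurable_step
  rw [lintegral_path_succ ν hb.measurable_init hF (by fun_prop)]
  simp only [Fin.snoc_apply_zero, Fin.snoc_last, Fin.snoc_castSucc]
  rw [hb.lintegral_path_last (h := fun z₀ u => ∫⁻ v, F (n + 1) u v * h z₀ u v ∂ν) (by omega)
    (by fun_prop), hb.lintegral_multi_step (by omega) hn hh]

end IsBridge

lemma lintegral_path_backward (hR : ∀ k, Measurable fun p : E × E => R k p.1 p.2) {T : ℕ}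
    (good : ℕ → E → Prop)
    (hgood : ∀ k < T, ∀ w, good (k + 1) w → ∀ u, R k w u ≠ 0 → good k u)
    (hR1 : ∀ k < T, ∀ w, good (k + 1) w → ∫⁻ u, R k w u ∂ν = 1)
    {b : E → ℝ≥0∞} (hbm : Measurable b) (hb : ∀ w, b w ≠ 0 → good T w) :
    ∫⁻ z : Fin (T + 1) → E, b (z (Fin.last T)) * pathProd (fun k u w => R k w u) T z
        ∂(Measure.pi fun _ => ν) = ∫⁻ w, b w ∂ν := by
  induction T generalizing b with
  | zero =>
    simp only [pathProd, Finset.univ_eq_empty, Finset.prod_empty, mul_one]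
    exact lintegral_path_zero ν b
  | succ T ih =>
    have hprod := measurable_pathProd (F := fun k u w => R k w u) (by fun_prop) T
    have hprod' := measurable_pathProd (F := fun k u w => R k w u) (by fun_prop) (T + 1)
    rw [lintegral_pi_snoc ν (by fun_prop)]
    simp_rw [pathProd_snoc, Fin.snoc_last]
    rw [lintegral_lintegral_swap (by fun_prop)]
    calc ∫⁻ v, ∫⁻ z : Fin (T + 1) → E, b v *
            (pathProd (fun k u w => R k w u) T z * R T v (z (Fin.last T)))
              ∂(Measure.pi fun _ => ν) ∂ν
        = ∫⁻ v, b v * ∫⁻ z : Fin (T + 1) → E, R T v (z (Fin.last T)) *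
            pathProd (fun k u w => R k w u) T z ∂(Measure.pi fun _ => ν) ∂ν := by
          simp_rw [mul_comm (pathProd _ T _)]
          exact lintegral_congr fun v => lintegral_const_mul _ (by fun_prop)
      _ = ∫⁻ v, b v * 1 ∂ν := lintegral_mul_congr fun v hv => by
          rw [ih (b := R T v) (fun k hk => hgood k (by omega)) (fun k hk => hR1 k (by omega))
            (by fun_prop) (hgood T (by omega) v (hb v hv)), hR1 T (by omega) v (hb v hv)]
      _ = ∫⁻ v, b v ∂ν := by simp only [mul_one]

end MarkovPath

/-! ### Isotropic Gaussian laws -/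

section Gaussian

variable {d : ℕ} {v : ℝ}

lemma gaussDensity_pos (μ : Latent d) (hv : 0 < v) (y : Latent d) : 0 < gaussDensity μ v y := by
  unfold gaussDensity; positivity

@[fun_prop]
lemma measurable_gaussDensity {α : Type*} [MeasurableSpace α] {m y : α → Latent d}
    (hm : Measurable m) (hy : Measurable y) : Measurable fun a => gaussDensity (m a) v (y a) := by
  unfold gaussDensity; fun_prop

lemma gaussDensity_eq_gaussDensity_zero (μ y : Latent d) :
    gaussDensity μ v y = gaussDensity 0 v (y - μ) := by simp [gaussDensity]

lemma gaussDensity_zero_eq (y : Latent d) :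
    gaussDensity 0 v y =
      (2 * Real.pi * v) ^ (-(d : ℝ) / 2) * Real.exp (-(2 * v)⁻¹ * ‖y‖ ^ 2) := by
  rw [gaussDensity, sub_zero]; congr 2; ring

lemma integral_gaussDensity (μ : Latent d) (hv : 0 < v) : ∫ y, gaussDensity μ v y = 1 := by
  simp_rw [gaussDensity_eq_gaussDensity_zero μ]
  rw [integral_sub_right_eq_self (gaussDensity 0 v)]
  simp_rw [gaussDensity_zero_eq]
  rw [integral_const_mul, GaussianFourier.integral_rexp_neg_mul_sq_norm (by positivity),
    div_inv_eq_mul, show Real.pi * (2 * v) = 2 * Real.pi * v by ring, finrank_euclideanSpace_fin,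
    neg_div, ← Real.rpow_add (by positivity), neg_add_cancel, Real.rpow_zero]

lemma isProbabilityMeasure_gaussLaw (μ : Latent d) (hv : 0 < v) :
    IsProbabilityMeasure (gaussLaw μ v) := by
  have hint : Integrable (gaussDensity μ v) :=
    .of_integral_ne_zero (by rw [integral_gaussDensity μ hv]; exact one_ne_zero)
  constructor
  rw [gaussLaw, withDensity_apply _ MeasurableSet.univ, Measure.restrict_univ,
    ← ofReal_integral_eq_lintegral_ofReal hint (ae_of_all _ fun y => (gaussDensity_pos μ hv y).le),
    integral_gaussDensity μ hv, ENNReal.ofReal_one]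

lemma lintegral_gaussLaw (μ : Latent d) (h : Latent d → ℝ≥0∞) :
    ∫⁻ y, h y ∂gaussLaw μ v = ∫⁻ y, ENNReal.ofReal (gaussDensity μ v y) * h y :=
  lintegral_withDensity_eq_lintegral_mul_non_measurable _ (by fun_prop)
    (ae_of_all _ fun _ => ENNReal.ofReal_lt_top) _

lemma charFun_gaussLaw (μ t : Latent d) (hv : 0 < v) :
    charFun (gaussLaw μ v) t =
      Complex.exp (inner ℝ t μ * Complex.I - v * (‖t‖ : ℂ) ^ 2 / 2) := by
  set C : ℝ := (2 * Real.pi * v) ^ (-(d : ℝ) / 2)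
  have hshift : charFun (gaussLaw μ v) t =
      ∫ y, gaussDensity 0 v y • Complex.exp (inner ℝ (y + μ) t * Complex.I) := by
    rw [charFun_apply, gaussLaw, integral_withDensity_eq_integral_toReal_smul (by fun_prop)
      (ae_of_all _ fun _ => ENNReal.ofReal_lt_top), ← integral_add_right_eq_self _ μ]
    simp_rw [ENNReal.toReal_ofReal (gaussDensity_pos μ hv _).le,
      gaussDensity_eq_gaussDensity_zero μ, add_sub_cancel_right]
  have hfactor (y : Latent d) : gaussDensity 0 v y • Complex.exp (inner ℝ (y + μ) t * Complex.I) =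
      C * Complex.exp (inner ℝ t μ * Complex.I) *
        Complex.exp (-((2 * v)⁻¹ : ℝ) * (‖y‖ : ℂ) ^ 2 + Complex.I * inner ℝ t y) := by
    rw [mul_assoc, ← Complex.exp_add, gaussDensity_zero_eq, Complex.real_smul, Complex.ofReal_mul,
      mul_assoc, Complex.ofReal_exp, ← Complex.exp_add, inner_add_left, real_inner_comm t,
      real_inner_comm t]
    congr 2
    push_cast
    ring
  have hb : 0 < (((2 * v)⁻¹ : ℝ) : ℂ).re := by rw [Complex.ofReal_re]; positivity
  have hconst : (C : ℂ) * (Real.pi / ((2 * v)⁻¹ : ℝ)) ^ ((d : ℂ) / 2) = 1 := by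
    have hpow : (Real.pi / ((2 * v)⁻¹ : ℝ) : ℂ) ^ ((d : ℂ) / 2) =
        ((2 * Real.pi * v) ^ ((d : ℝ) / 2) : ℝ) := by
      rw [Complex.ofReal_cpow (by positivity)]
      push_cast
      rw [div_inv_eq_mul]
      ring_nf
    rw [hpow, ← Complex.ofReal_mul, ← Real.rpow_add (by positivity), neg_div, neg_add_cancel,
      Real.rpow_zero, Complex.ofReal_one]
  simp_rw [hshift, hfactor]
  rw [integral_const_mul, GaussianFourier.integral_cexp_neg_mul_sq_norm_add hb,
    finrank_euclideanSpace_fin, mul_right_comm, ← mul_assoc, hconst, one_mul, ← Complex.exp_add]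
  congr 1
  rw [Complex.I_sq]
  push_cast
  field_simp
  ring

lemma gaussLaw_eq_multivariateGaussian (μ : Latent d) (hv : 0 < v) :
    gaussLaw μ v = multivariateGaussian μ (v • 1) := by
  have := isProbabilityMeasure_gaussLaw μ hv
  refine Measure.ext_of_charFun (funext fun t => ?_)
  rw [charFun_gaussLaw μ t hv, charFun_multivariateGaussian (Matrix.PosSemidef.one.smul hv.le)]
  have hquad : t.ofLp ⬝ᵥ ((v • (1 : Matrix (Fin d) (Fin d) ℝ)) *ᵥ t.ofLp) = v * ‖t‖ ^ 2 := by
    rw [Matrix.smul_mulVec, Matrix.one_mulVec, dotProduct_smul, smul_eq_mul,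
      EuclideanSpace.norm_sq_eq]
    simp [dotProduct, sq]
  rw [hquad]
  push_cast
  rfl

/-- The energy `‖y - c‖² / (2 v)` of the Gaussian law with mean `c` and covariance `v I_d`. -/
def gaussEnergy (c : Latent d) (v : ℝ) (y : Latent d) : ℝ≥0∞ :=
  ENNReal.ofReal (‖y - c‖ ^ 2 / (2 * v))

@[fun_prop]
lemma measurable_gaussEnergy {α : Type*} [MeasurableSpace α] {c y : α → Latent d}
    (hc : Measurable c) (hy : Measurable y) : Measurable fun a => gaussEnergy (c a) v (y a) := by
  unfold gaussEnergy; fun_prop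

@[simp]
lemma gaussEnergy_self (c : Latent d) : gaussEnergy c v c = 0 := by simp [gaussEnergy]

lemma gaussDensity_mul_expNeg_gaussEnergy (μ c y : Latent d) (hv : 0 < v) :
    ENNReal.ofReal (gaussDensity c v y) * expNeg (gaussEnergy μ v y) =
      ENNReal.ofReal (gaussDensity μ v y) * expNeg (gaussEnergy c v y) := by
  rw [gaussEnergy, expNeg_ofReal (by positivity), gaussEnergy, expNeg_ofReal (by positivity),
    ← ENNReal.ofReal_mul (gaussDensity_pos c hv y).le,
    ← ENNReal.ofReal_mul (gaussDensity_pos μ hv y).le]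
  simp only [gaussDensity, neg_div, mul_right_comm]

lemma gaussEnergy_eq_sum (c : Latent d) (hv : 0 < v) (y : Latent d) :
    gaussEnergy c v y = ENNReal.ofReal (2 * v)⁻¹ * ∑ i, ENNReal.ofReal ((y i - c i) ^ 2) := by
  rw [gaussEnergy, ← ENNReal.ofReal_sum_of_nonneg fun i _ => sq_nonneg _,
    ← ENNReal.ofReal_mul (by positivity), EuclideanSpace.norm_sq_eq, div_eq_inv_mul]
  simp only [PiLp.sub_apply, Real.norm_eq_abs, sq_abs]

lemma lintegral_gaussianReal_sub_sq (m c : ℝ) (w : NNReal) :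
    ∫⁻ x, ENNReal.ofReal ((x - c) ^ 2) ∂gaussianReal m w = ENNReal.ofReal (w + (m - c) ^ 2) := by
  have hsub : (gaussianReal m w).map (fun x => x - c) = gaussianReal (m - c) w :=
    gaussianReal_map_sub_const c
  have hmem : MemLp id 2 (gaussianReal (m - c) w) := memLp_id_gaussianReal 2
  have hsq : ∫ x, x ^ 2 ∂gaussianReal (m - c) w = w + (m - c) ^ 2 := by
    have hvar := variance_eq_sub hmem
    rw [variance_id_gaussianReal] at hvar
    simp only [Pi.pow_apply, id_eq, integral_id_gaussianReal] at hvar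
    linarith
  rw [← lintegral_map (f := fun x => ENNReal.ofReal (x ^ 2)) (by fun_prop) (by fun_prop), hsub,
    ← hsq]
  exact (ofReal_integral_eq_lintegral_ofReal hmem.integrable_sq
    (ae_of_all _ fun x => sq_nonneg x)).symm

lemma lintegral_gaussEnergy (μ c : Latent d) (hv : 0 < v) :
    ∫⁻ y, gaussEnergy c v y ∂gaussLaw μ v = ENNReal.ofReal (d / 2) + gaussEnergy c v μ := by
  have hcoord (i : Fin d) : ∫⁻ y : Latent d, ENNReal.ofReal ((y i - c i) ^ 2) ∂gaussLaw μ v =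
      ENNReal.ofReal (v + (μ i - c i) ^ 2) := by
    have hi := measurePreserving_eval_multivariateGaussian (μ := μ)
      (Matrix.PosSemidef.one.smul hv.le : (v • (1 : Matrix (Fin d) (Fin d) ℝ)).PosSemidef) (i := i)
    rw [gaussLaw_eq_multivariateGaussian μ hv,
      hi.lintegral_comp (f := fun x => ENNReal.ofReal ((x - c i) ^ 2)) (by fun_prop),
      lintegral_gaussianReal_sub_sq]
    simp [hv.le]
  calc ∫⁻ y, gaussEnergy c v y ∂gaussLaw μ v
      = ∫⁻ y, ENNReal.ofReal (2 * v)⁻¹ * ∑ i, ENNReal.ofReal ((y i - c i) ^ 2) ∂gaussLaw μ v := by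
        simp_rw [gaussEnergy_eq_sum c hv]
    _ = ENNReal.ofReal (2 * v)⁻¹ * ∑ i, ENNReal.ofReal (v + (μ i - c i) ^ 2) := by
        rw [lintegral_const_mul _ (by fun_prop), lintegral_finsetSum _ (by fun_prop)]
        simp_rw [hcoord]
    _ = ENNReal.ofReal (2 * v)⁻¹ * (ENNReal.ofReal (d * v) +
          ∑ i, ENNReal.ofReal ((μ i - c i) ^ 2)) := by
        simp_rw [ENNReal.ofReal_add hv.le (sq_nonneg _), Finset.sum_add_distrib]
        simp [ENNReal.ofReal_mul]
    _ = ENNReal.ofReal (d / 2) + gaussEnergy c v μ := by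
        rw [mul_add, ← ENNReal.ofReal_mul (by positivity), gaussEnergy_eq_sum c hv]
        congr 2
        field_simp

lemma klDiv_gaussLaw (μ c : Latent d) (hv : 0 < v) :
    klDiv (gaussLaw μ v) (gaussLaw c v) = gaussEnergy c v μ := by
  have := isProbabilityMeasure_gaussLaw μ hv
  have := isProbabilityMeasure_gaussLaw c hv
  have hN : ∫⁻ y, gaussEnergy μ v y ∂gaussLaw μ v = ENNReal.ofReal (d / 2) := by
    rw [lintegral_gaussEnergy μ μ hv, gaussEnergy_self, add_zero]
  have hkl : klDiv (gaussLaw μ v) (gaussLaw c v) +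
      ∫⁻ y, gaussEnergy μ v y ∂gaussLaw μ v = ∫⁻ y, gaussEnergy c v y ∂gaussLaw μ v := by
    unfold gaussLaw at *
    exact klDiv_withDensity_add_lintegral (by fun_prop) (by fun_prop) (by fun_prop) (by fun_prop)
      (by simp [hN]) fun y _ => gaussDensity_mul_expNeg_gaussEnergy μ c y hv
  rw [hN, lintegral_gaussEnergy μ c hv, add_comm] at hkl
  exact (ENNReal.add_right_inj ENNReal.ofReal_ne_top).1 hkl

lemma gaussDensity_bayes (m u w : Latent d) (a : ℝ) {s r : ℝ} (hs : 0 < s) (hr : 0 < r) :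
    gaussDensity m s u * gaussDensity (a • u) r w =
      gaussDensity (a • m) (a ^ 2 * s + r) w *
        gaussDensity ((a * s / (a ^ 2 * s + r)) • w + (r / (a ^ 2 * s + r)) • m)
          (s * r / (a ^ 2 * s + r)) u := by
  have : 0 < a ^ 2 * s + r := by positivity
  have hconst : (2 * Real.pi * s) ^ (-(d : ℝ) / 2) * (2 * Real.pi * r) ^ (-(d : ℝ) / 2) =
      (2 * Real.pi * (a ^ 2 * s + r)) ^ (-(d : ℝ) / 2) *
        (2 * Real.pi * (s * r / (a ^ 2 * s + r))) ^ (-(d : ℝ) / 2) := by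
    rw [← Real.mul_rpow (by positivity) (by positivity),
      ← Real.mul_rpow (by positivity) (by positivity)]
    congr 1; field_simp
  have hexp : -‖u - m‖ ^ 2 / (2 * s) + -‖w - a • u‖ ^ 2 / (2 * r) =
      -‖w - a • m‖ ^ 2 / (2 * (a ^ 2 * s + r)) +
        -‖u - ((a * s / (a ^ 2 * s + r)) • w + (r / (a ^ 2 * s + r)) • m)‖ ^ 2 /
          (2 * (s * r / (a ^ 2 * s + r))) := by
    simp only [EuclideanSpace.norm_sq_eq, Real.norm_eq_abs, sq_abs, PiLp.sub_apply,
      PiLp.smul_apply, PiLp.add_apply, smul_eq_mul, ← Finset.sum_neg_distrib, Finset.sum_div,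
      ← Finset.sum_add_distrib]
    refine Finset.sum_congr rfl fun i _ => ?_
    generalize u i = u, w i = w, m i = m
    field_simp
    ring
  unfold gaussDensity
  rw [mul_mul_mul_comm, ← Real.exp_add, mul_mul_mul_comm, ← Real.exp_add, hconst, hexp]

lemma measurable_gaussLaw_smul (a v : ℝ) : Measurable fun u : Latent d => gaussLaw (a • u) v := by
  refine Measure.measurable_of_measurable_coe _ fun A hA => ?_
  simp_rw [gaussLaw, withDensity_apply _ hA]
  fun_prop

lemma gaussLaw_bind (m : Latent d) (a : ℝ) {s r : ℝ} (hs : 0 < s) (hr : 0 < r) :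
    (gaussLaw m s).bind (fun u => gaussLaw (a • u) r) = gaussLaw (a • m) (a ^ 2 * s + r) := by
  have hv : 0 < a ^ 2 * s + r := by positivity
  have hbayes (u w : Latent d) := congrArg ENNReal.ofReal (gaussDensity_bayes m u w a hs hr)
  simp_rw [ENNReal.ofReal_mul (gaussDensity_pos _ hs _).le,
    ENNReal.ofReal_mul (gaussDensity_pos _ hv _).le] at hbayes
  ext A hA
  rw [Measure.bind_apply hA (measurable_gaussLaw_smul a r).aemeasurable, lintegral_gaussLaw]
  simp_rw [gaussLaw, withDensity_apply _ hA]
  calc ∫⁻ u, ENNReal.ofReal (gaussDensity m s u) *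
        ∫⁻ w in A, ENNReal.ofReal (gaussDensity (a • u) r w)
      = ∫⁻ u, ∫⁻ w in A, ENNReal.ofReal (gaussDensity m s u) *
          ENNReal.ofReal (gaussDensity (a • u) r w) :=
        lintegral_congr fun u => (lintegral_const_mul _ (by fun_prop)).symm
    _ = ∫⁻ w in A, ∫⁻ u, ENNReal.ofReal (gaussDensity m s u) *
          ENNReal.ofReal (gaussDensity (a • u) r w) :=
        lintegral_lintegral_swap (Measurable.aemeasurable (by fun_prop))
    _ = ∫⁻ w in A, ENNReal.ofReal (gaussDensity (a • m) (a ^ 2 * s + r) w) := by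
        simp_rw [hbayes]
        refine lintegral_congr fun w => ?_
        have := isProbabilityMeasure_gaussLaw
          ((a * s / (a ^ 2 * s + r)) • w + (r / (a ^ 2 * s + r)) • m)
          (show 0 < s * r / (a ^ 2 * s + r) by positivity)
        rw [lintegral_const_mul _ (by fun_prop), ← setLIntegral_univ,
          ← withDensity_apply _ MeasurableSet.univ, ← gaussLaw, measure_univ, mul_one]

end Gaussian

/-! ### Masking of a single token -/

section Token

variable {V : ℕ}

lemma oneHot_self (v : Tok V) : oneHot v v = 1 := by simp [oneHot]

lemma oneHot_nonneg (v w : Tok V) : 0 ≤ oneHot v w := by unfold oneHot; split_ifs <;> simp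

lemma sum_oneHot (v : Tok V) : ∑ w, oneHot v w = 1 := by simp [oneHot]

lemma tokForward_nonneg {g : ℝ} (h0 : 0 ≤ g) (h1 : g ≤ 1) (x x' : Tok V) :
    0 ≤ tokForward g x x' := by
  have := oneHot_nonneg x x'
  have := oneHot_nonneg (mask V) x'
  have : 0 ≤ 1 - g := by linarith
  unfold tokForward; split_ifs <;> positivity

lemma sum_tokForward (g : ℝ) (x : Tok V) : ∑ x', tokForward g x x' = 1 := by
  unfold tokForward; split_ifs
  · exact sum_oneHot _
  · rw [Finset.sum_add_distrib, ← Finset.mul_sum, ← Finset.mul_sum, sum_oneHot, sum_oneHot]; ring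

lemma tokForward_zero (x x' : Tok V) : tokForward 0 x x' = oneHot (mask V) x' := by
  simp [tokForward]

lemma tokForward_one (x x' : Tok V) : tokForward 1 x x' = oneHot x x' := by
  unfold tokForward; split_ifs with h <;> simp [h]

lemma tokBridge_nonneg {gs gt : ℝ} (hst : gt ≤ gs) (hs : gs ≤ 1) (x : Tok V) {p : Tok V → ℝ}
    (hp : ∀ v, 0 ≤ p v) (x' : Tok V) : 0 ≤ tokBridge gs gt x p x' := by
  have := oneHot_nonneg x x'
  have := oneHot_nonneg (mask V) x'
  have := hp x'
  have : 0 ≤ 1 - gs := by linarith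
  have : 0 ≤ gs - gt := by linarith
  have : 0 ≤ 1 - gt := by linarith
  unfold tokBridge; split_ifs <;> positivity

lemma sum_tokBridge {gs gt : ℝ} {x : Tok V} {p : Tok V → ℝ} (hp : ∑ v, p v = 1)
    (hx : x = mask V → gt < 1) : ∑ x', tokBridge gs gt x p x' = 1 := by
  unfold tokBridge; split_ifs with h
  · rw [← Finset.sum_div, Finset.sum_add_distrib, ← Finset.mul_sum, ← Finset.mul_sum, sum_oneHot,
      hp, mul_one, mul_one]
    have : 1 - gt ≠ 0 := by linarith [hx h]
    field_simp; ring
  · exact sum_oneHot _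

lemma tokBridge_le_one {gs gt : ℝ} (hst : gt ≤ gs) (hs : gs ≤ 1) (x : Tok V) {p : Tok V → ℝ}
    (hp0 : ∀ v, 0 ≤ p v) (hp : ∑ v, p v = 1) (x' : Tok V) : tokBridge gs gt x p x' ≤ 1 := by
  by_cases hx : x = mask V → gt < 1
  · rw [← sum_tokBridge (gs := gs) hp hx]
    exact Finset.single_le_sum (f := fun v => tokBridge gs gt x p v)
      (fun v _ => tokBridge_nonneg hst hs x hp0 v) (Finset.mem_univ x')
  · push Not at hx
    have : gt = 1 := le_antisymm (hst.trans hs) hx.2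
    simp [tokBridge, hx.1, this]

lemma tokForward_bayes {gs g : ℝ} (hs : gs ≤ 1) (hg : g ≤ 1) (hs0 : 0 ≤ gs)
    {x₀ : Tok V} (hx₀ : x₀ ≠ mask V) (u w : Tok V) :
    tokForward gs x₀ u * tokForward g u w =
      tokForward (gs * g) x₀ w * tokBridge gs (gs * g) w (oneHot x₀) u := by
  by_cases hw : w = mask V
  · subst hw
    have e : tokForward (gs * g) x₀ (mask V) = 1 - gs * g := by
      simp [tokForward, hx₀, oneHot, hx₀.symm]
    have hB : (1 - gs * g) * tokBridge gs (gs * g) (mask V) (oneHot x₀) u =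
        (1 - gs) * oneHot (mask V) u + (gs - gs * g) * oneHot x₀ u := by
      by_cases h1 : 1 - gs * g = 0
      · have h2 : gs = 1 := by nlinarith
        have h3 : g = 1 := by rw [h2] at h1; linarith
        simp [h2, h3]
      · simp only [tokBridge, if_true]; field_simp
    rw [e, hB]
    by_cases hu : u = mask V
    · subst hu
      simp [tokForward, hx₀, oneHot, hx₀.symm]
    · by_cases hux : u = x₀
      · subst hux; simp [tokForward, hx₀, oneHot, Ne.symm hx₀]; ring
      · simp [tokForward, hx₀, oneHot, hu, hux]
  · by_cases hux : w = u
    · subst hux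
      by_cases hwx : w = x₀
      · subst hwx; simp [tokForward, tokBridge, oneHot, hw]
      · simp [tokForward, tokBridge, oneHot, hw, hwx, hx₀]
    · by_cases hu : u = mask V
      · simp [tokForward, tokBridge, oneHot, hw, hu, Ne.symm hw]
      · simp [tokForward, tokBridge, oneHot, hw, hu, hux, Ne.symm hux]

lemma tokForward_one_mask {x₀ : Tok V} (hx₀ : x₀ ≠ mask V) : tokForward 1 x₀ (mask V) = 0 := by
  simp [tokForward, hx₀, oneHot, Ne.symm hx₀]

lemma tokBridge_eq_oneHot_mul {gs gt : ℝ} {x₀ : Tok V} (hx₀ : x₀ ≠ mask V) {p : Tok V → ℝ}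
    (hp : p (mask V) = 0) {w u : Tok V} (h : tokBridge gs gt w (oneHot x₀) u ≠ 0) :
    tokBridge gs gt w p u = tokBridge gs gt w (oneHot x₀) u *
      (if w = mask V ∧ u ≠ mask V then p x₀ else 1) := by
  unfold tokBridge at *
  by_cases hw : w = mask V
  · simp only [hw, if_true, true_and] at h ⊢
    by_cases hu : u = mask V
    · simp [hu, hp, oneHot, Ne.symm hx₀]
    · by_cases hux : u = x₀
      · simp [hux, oneHot, hx₀]; ring
      · simp [oneHot, hu, hux] at h
  · simp [hw]

lemma sum_tokBridge_mul_unmask {gs gt : ℝ} {x₀ : Tok V} (hx₀ : x₀ ≠ mask V)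
    (w : Tok V) (c : ℝ≥0∞) :
    ∑ u, ENNReal.ofReal (tokBridge gs gt w (oneHot x₀) u) *
        (if w = mask V ∧ u ≠ mask V then c else 0) =
      if w = mask V then ENNReal.ofReal ((gs - gt) / (1 - gt)) * c else 0 := by
  by_cases hw : w = mask V
  · simp only [hw, if_true, true_and]
    rw [Finset.sum_eq_single x₀]
    · simp [hx₀, tokBridge, oneHot]
    · intro u _ hu
      by_cases hum : u = mask V
      · simp [hum]
      · simp [tokBridge, oneHot, hu, hum]
    · simp
  · simp [hw]

end Token

/-! ### Products over positions -/

section Product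

variable {ι A : Type*} [Fintype ι] [DecidableEq ι] [Fintype A]

lemma sum_prod_eq_one {R : Type*} [CommSemiring R] {p : ι → A → R} (hp : ∀ i, ∑ v, p i v = 1) :
    ∑ u : ι → A, ∏ i, p i (u i) = 1 := by
  simp_rw [← Fintype.prod_sum, hp, Finset.prod_const_one]

lemma sum_prod_mul_sum {R : Type*} [CommSemiring R] {p φ : ι → A → R}
    (hp : ∀ i, ∑ v, p i v = 1) :
    ∑ u : ι → A, (∏ i, p i (u i)) * ∑ i, φ i (u i) = ∑ i, ∑ v, p i v * φ i v := by
  simp_rw [Finset.mul_sum]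
  rw [Finset.sum_comm]
  refine Finset.sum_congr rfl fun j _ => ?_
  have hfactor (u : ι → A) : (∏ i, p i (u i)) * φ j (u j) =
      ∏ i, p i (u i) * if i = j then φ i (u i) else 1 := by
    rw [Finset.prod_mul_distrib]; simp
  simp_rw [hfactor]
  rw [← Fintype.prod_sum fun i v => p i v * if i = j then φ i v else 1,
    Fintype.prod_eq_single j fun i hi => by simp [hi, hp]]
  simp

end Product

namespace Model

variable {S V d T : ℕ} (M : Model S V d T)

/-! ### Schedules -/

lemma gamBar_zero : M.gamBar 0 = 1 := by simp [gamBar]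

lemma gamBar_succ (t : ℕ) : M.gamBar (t + 1) = M.gamBar t * M.gam (t + 1) :=
  Finset.prod_Icc_succ_top (by omega) _

lemma gamBar_last : M.gamBar T = 0 := M.gam_prod

lemma alphaBar_succ (t : ℕ) : M.alphaBar (t + 1) = M.alphaBar t * M.alpha (t + 1) :=
  Finset.prod_Icc_succ_top (by omega) _

lemma gamBar_nonneg {t : ℕ} (ht : t ≤ T) : 0 ≤ M.gamBar t := by
  refine Finset.prod_nonneg fun s hs => ?_
  rw [Finset.mem_Icc] at hs
  exact (M.gam_mem s hs.1 (hs.2.trans ht)).1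

lemma gamBar_succ_le {t : ℕ} (ht : t < T) : M.gamBar (t + 1) ≤ M.gamBar t := by
  rw [gamBar_succ]
  exact mul_le_of_le_one_right (M.gamBar_nonneg ht.le) (M.gam_mem (t + 1) (by omega) ht).2

lemma gamBar_le_one {t : ℕ} (ht : t ≤ T) : M.gamBar t ≤ 1 := by
  induction t with
  | zero => rw [gamBar_zero]
  | succ t ih => exact (M.gamBar_succ_le ht).trans (ih (by omega))

lemma one_le_horizon (M : Model S V d T) : 1 ≤ T := by
  by_contra h
  have h0 : T = 0 := by omega
  have h1 := M.gamBar_last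
  rw [show M.gamBar T = M.gamBar 0 from congrArg _ h0, gamBar_zero] at h1
  exact one_ne_zero h1

lemma sigmaBarSq_nonneg (t : ℕ) : 0 ≤ M.sigmaBarSq t := by
  induction t with
  | zero => simp [sigmaBarSq]
  | succ t ih => rw [sigmaBarSq]; positivity

lemma sigmaBarSq_pos {t : ℕ} (h1 : 1 ≤ t) (ht : t ≤ T) : 0 < M.sigmaBarSq t := by
  obtain ⟨t, rfl⟩ : ∃ s, t = s + 1 := ⟨t - 1, by omega⟩
  have := M.sigmaBarSq_nonneg t
  have := M.sigma_pos _ h1 ht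
  rw [sigmaBarSq]; positivity

lemma sigma_sq_pos {t : ℕ} (h1 : 1 ≤ t) (ht : t ≤ T) : 0 < M.sigma t ^ 2 :=
  pow_pos (M.sigma_pos _ h1 ht) _

lemma sigmaLat_sq_pos : 0 < M.sigmaLat ^ 2 := pow_pos M.sigmaLat_pos _

lemma bridgeVar_pos {t : ℕ} (h1 : 1 ≤ t) (ht : t < T) : 0 < M.bridgeVar (t + 1) := by
  have := M.sigmaBarSq_pos h1 ht.le
  have := M.sigmaBarSq_pos (t := t + 1) (by omega) ht
  have := M.sigma_sq_pos (t := t + 1) (by omega) ht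
  unfold bridgeVar; simp only [Nat.add_sub_cancel]; positivity

lemma weightX_nonpos {t : ℕ} (ht : t < T) : M.weightX (t + 1) ≤ 0 := by
  unfold weightX
  refine div_nonpos_of_nonpos_of_nonneg ?_ ?_
  · have := M.gamBar_succ_le ht; simp only [Nat.add_sub_cancel]; linarith
  · linarith [M.gamBar_le_one (t := t + 1) ht]

/-! ### Multi-step transitions and bridges -/

/-- The law of the tokens at time `t` given the tokens at time `0`. -/
def xMulti (t : ℕ) (x₀ x : TokSeq S V) : ℝ := ∏ i, tokForward (M.gamBar t) (x₀ i) (x i)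

/-- The law of the tokens at time `t` given the tokens at times `t + 1` and `0`. -/
def xBridge (t : ℕ) (x₀ x u : TokSeq S V) : ℝ :=
  ∏ i, tokBridge (M.gamBar t) (M.gamBar (t + 1)) (x i) (oneHot (x₀ i)) (u i)

lemma xForward_nonneg {t : ℕ} (h1 : 1 ≤ t) (ht : t ≤ T) (x x' : TokSeq S V) :
    0 ≤ M.xForward t x x' :=
  Finset.prod_nonneg fun _ _ =>
    tokForward_nonneg (M.gam_mem t h1 ht).1 (M.gam_mem t h1 ht).2 _ _

lemma xMulti_nonneg {t : ℕ} (ht : t ≤ T) (x x' : TokSeq S V) : 0 ≤ M.xMulti t x x' :=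
  Finset.prod_nonneg fun _ _ => tokForward_nonneg (M.gamBar_nonneg ht) (M.gamBar_le_one ht) _ _

lemma xBridge_nonneg {t : ℕ} (ht : t < T) (x₀ x u : TokSeq S V) : 0 ≤ M.xBridge t x₀ x u :=
  Finset.prod_nonneg fun _ _ =>
    tokBridge_nonneg (M.gamBar_succ_le ht) (M.gamBar_le_one ht.le) _ (oneHot_nonneg _) _

lemma sum_xForward (t : ℕ) (x : TokSeq S V) : ∑ x', M.xForward t x x' = 1 :=
  sum_prod_eq_one fun _ => sum_tokForward _ _

lemma xMulti_one (x x' : TokSeq S V) : M.xMulti 1 x x' = M.xForward 1 x x' := by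
  simp [xMulti, xForward, gamBar]

lemma xMulti_last (x x' : TokSeq S V) :
    M.xMulti T x x' = if x' = (fun _ => mask V) then 1 else 0 := by
  simp only [xMulti, gamBar_last, tokForward_zero, oneHot]
  rw [Finset.prod_ite_zero]
  simp [funext_iff]

lemma xMulti_mul_xForward {t : ℕ} (ht : t < T) {x₀ : TokSeq S V} (hx₀ : ∀ i, x₀ i ≠ mask V)
    (u w : TokSeq S V) :
    M.xMulti t x₀ u * M.xForward (t + 1) u w = M.xMulti (t + 1) x₀ w * M.xBridge t x₀ w u := by
  simp only [xMulti, xForward, xBridge, gamBar_succ, ← Finset.prod_mul_distrib]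
  exact Finset.prod_congr rfl fun i _ => tokForward_bayes (M.gamBar_le_one ht.le)
    (M.gam_mem (t + 1) (by omega) ht).2 (M.gamBar_nonneg ht.le) (hx₀ i) _ _

lemma gaussDensity_mul_yForward {t : ℕ} (h1 : 1 ≤ t) (ht : t < T) (y₀ u w : Latent d) :
    gaussDensity (M.alphaBar t • y₀) (M.sigmaBarSq t) u * M.yForward (t + 1) u w =
      gaussDensity (M.alphaBar (t + 1) • y₀) (M.sigmaBarSq (t + 1)) w *
        gaussDensity (M.bridgeMean (t + 1) w y₀) (M.bridgeVar (t + 1)) u := by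
  rw [yForward, gaussDensity_bayes (M.alphaBar t • y₀) u w (M.alpha (t + 1))
    (M.sigmaBarSq_pos h1 ht.le) (M.sigma_sq_pos (t := t + 1) (by omega) ht), bridgeMean, bridgeVar,
    Nat.add_sub_cancel, smul_smul, smul_smul, alphaBar_succ, mul_comm (M.alpha _) (M.alphaBar _),
    sigmaBarSq, div_mul_eq_mul_div, mul_comm (M.sigma _ ^ 2) (M.alphaBar _)]

lemma gamBar_lt_one_of_xMulti_ne_zero {t : ℕ} (ht : t ≤ T) {x₀ x : TokSeq S V}
    (hx₀ : ∀ i, x₀ i ≠ mask V) (h : M.xMulti t x₀ x ≠ 0) {i : Fin S} (hi : x i = mask V) :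
    M.gamBar t < 1 := by
  refine lt_of_le_of_ne (M.gamBar_le_one ht) fun h1 => ?_
  have := Finset.prod_ne_zero_iff.1 h i (Finset.mem_univ _)
  rw [h1, hi, tokForward_one_mask (hx₀ i)] at this
  exact this rfl

lemma sum_xBridge {t : ℕ} (ht : t < T) {x₀ x : TokSeq S V} (hx₀ : ∀ i, x₀ i ≠ mask V)
    (h : M.xMulti (t + 1) x₀ x ≠ 0) : ∑ u, M.xBridge t x₀ x u = 1 :=
  sum_prod_eq_one fun _ => sum_tokBridge (sum_oneHot _) fun hi =>
    M.gamBar_lt_one_of_xMulti_ne_zero (t := t + 1) ht hx₀ h hi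

end Model

/-! ### States with independent channels -/

section State

variable {S V d : ℕ}

/-- The reference measure on states: counting measure on tokens times Lebesgue measure on
latents. -/
abbrev stateRef (S V d : ℕ) : Measure (State S V d) := Measure.count.prod volume

/-- The density of a state whose tokens have law `p` and whose latent is independent of them with
law `N(m, v I_d)`. -/
def stateDensity (p : TokSeq S V → ℝ) (m : Latent d) (v : ℝ) (z : State S V d) : ℝ≥0∞ :=
  ENNReal.ofReal (p z.1) * ENNReal.ofReal (gaussDensity m v z.2)

@[fun_prop]
lemma measurable_stateDensity {A : Type*} [MeasurableSpace A] {p : A → TokSeq S V → ℝ}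
    {m : A → Latent d} {z : A → State S V d} (v : ℝ) (hp : ∀ x, Measurable fun a => p a x)
    (hm : Measurable m) (hz : Measurable z) :
    Measurable fun a => stateDensity (p a) (m a) v (z a) := by
  have hpz : Measurable fun a => p a (z a).1 :=
    (measurable_from_prod_countable_left (f := fun q : A × TokSeq S V => p q.1 q.2) hp).comp
      (by fun_prop : Measurable fun a => (a, (z a).1))
  exact hpz.ennreal_ofReal.mul (by fun_prop)

lemma stateDensity_eq_ofReal {p : TokSeq S V → ℝ} (hp : ∀ x, 0 ≤ p x) (m : Latent d) (v : ℝ)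
    (z : State S V d) :
    stateDensity p m v z = ENNReal.ofReal (p z.1 * gaussDensity m v z.2) :=
  (ENNReal.ofReal_mul (hp _)).symm

lemma lintegral_stateDensity (p : TokSeq S V → ℝ) (m : Latent d) (v : ℝ)
    {h : State S V d → ℝ≥0∞} (hh : Measurable h) :
    ∫⁻ z, stateDensity p m v z * h z ∂stateRef S V d =
      ∑ x, ENNReal.ofReal (p x) * ∫⁻ y, h (x, y) ∂gaussLaw m v := by
  have : Measurable p := .of_discrete
  rw [lintegral_prod _ (by fun_prop), lintegral_count, tsum_fintype]
  refine Finset.sum_congr rfl fun x _ => ?_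
  simp_rw [stateDensity, mul_assoc]
  rw [lintegral_const_mul _ (by fun_prop), lintegral_gaussLaw]

lemma lintegral_stateDensity_snd {p : TokSeq S V → ℝ} (hp : ∀ x, 0 ≤ p x) (hp1 : ∑ x, p x = 1)
    (m : Latent d) (v : ℝ) {h : Latent d → ℝ≥0∞} (hh : Measurable h) :
    ∫⁻ z, stateDensity p m v z * h z.2 ∂stateRef S V d = ∫⁻ y, h y ∂gaussLaw m v := by
  rw [lintegral_stateDensity p m v (h := fun z => h z.2) (by fun_prop)]
  simp only [← Finset.sum_mul, ← ENNReal.ofReal_sum_of_nonneg fun x _ => hp x, hp1,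
    ENNReal.ofReal_one, one_mul]

lemma lintegral_stateDensity_fst (p : TokSeq S V → ℝ) (m : Latent d) {v : ℝ} (hv : 0 < v)
    (h : TokSeq S V → ℝ≥0∞) :
    ∫⁻ z, stateDensity p m v z * h z.1 ∂stateRef S V d = ∑ x, ENNReal.ofReal (p x) * h x := by
  have := isProbabilityMeasure_gaussLaw m hv
  have hh : Measurable h := .of_discrete
  rw [lintegral_stateDensity p m v (h := fun z => h z.1) (by fun_prop)]
  simp

lemma lintegral_stateDensity_eq_one {p : TokSeq S V → ℝ} (hp : ∀ x, 0 ≤ p x)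
    (hp1 : ∑ x, p x = 1) (m : Latent d) {v : ℝ} (hv : 0 < v) :
    ∫⁻ z, stateDensity p m v z ∂stateRef S V d = 1 := by
  have := isProbabilityMeasure_gaussLaw m hv
  simpa using lintegral_stateDensity_snd hp hp1 m v (h := fun _ => 1) measurable_const

end State

namespace Model

variable {S V d T : ℕ} (M : Model S V d T)

/-! ### The forward process as a Markov chain with bridges -/

/-- The density of `Z_0` given `X_0 = x₀`. -/
def fwdInit (x₀ : TokSeq S V) : State S V d → ℝ≥0∞ :=
  stateDensity (fun x => if x = x₀ then 1 else 0) (M.encMean x₀) (M.sigmaLat ^ 2)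

/-- The density of `Z_{k+1}` given `Z_k = u`. -/
def fwdStep (k : ℕ) (u : State S V d) : State S V d → ℝ≥0∞ :=
  stateDensity (M.xForward (k + 1) u.1) (M.alpha (k + 1) • u.2) (M.sigma (k + 1) ^ 2)

/-- The density of `Z_k` given `Z_0 = z₀`. -/
def fwdMulti (k : ℕ) (z₀ : State S V d) : State S V d → ℝ≥0∞ :=
  stateDensity (M.xMulti k z₀.1) (M.alphaBar k • z₀.2) (M.sigmaBarSq k)

/-- The density of `Z_k` given `Z_{k+1} = w` and `Z_0 = z₀`. -/
def fwdBridge (k : ℕ) (z₀ w : State S V d) : State S V d → ℝ≥0∞ :=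
  stateDensity (M.xBridge k z₀.1 w.1) (M.bridgeMean (k + 1) w.2 z₀.2) (M.bridgeVar (k + 1))

@[fun_prop]
lemma measurable_bridgeMean {A : Type*} [MeasurableSpace A] (t : ℕ) {y y' : A → Latent d}
    (hy : Measurable y) (hy' : Measurable y') :
    Measurable fun a => M.bridgeMean t (y a) (y' a) := by
  unfold bridgeMean; fun_prop

lemma measurable_fwdInit (x₀ : TokSeq S V) : Measurable (M.fwdInit x₀) := by
  unfold fwdInit; fun_prop

lemma measurable_fwdStep (k : ℕ) :
    Measurable fun p : State S V d × State S V d => M.fwdStep k p.1 p.2 := by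
  have hx (x : TokSeq S V) : Measurable fun u => M.xForward (k + 1) u x := .of_discrete
  unfold fwdStep; fun_prop

lemma measurable_fwdMulti (k : ℕ) :
    Measurable fun p : State S V d × State S V d => M.fwdMulti k p.1 p.2 := by
  have hx (x : TokSeq S V) : Measurable fun u => M.xMulti k u x := .of_discrete
  unfold fwdMulti; fun_prop

lemma measurable_fwdBridge (k : ℕ) : Measurable
    fun p : State S V d × State S V d × State S V d => M.fwdBridge k p.1 p.2.1 p.2.2 := by
  have hx (x : TokSeq S V) : Measurable fun q : TokSeq S V × TokSeq S V =>
      M.xBridge k q.1 q.2 x := .of_discrete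
  have hx' (x : TokSeq S V) : Measurable fun p : State S V d × State S V d × State S V d =>
      M.xBridge k p.1.1 p.2.1.1 x :=
    (hx x).comp (by fun_prop : Measurable fun p : State S V d × State S V d × State S V d =>
      (p.1.1, p.2.1.1))
  unfold fwdBridge; fun_prop

lemma lintegral_fwdInit (x₀ : TokSeq S V) : ∫⁻ z, M.fwdInit x₀ z ∂stateRef S V d = 1 :=
  lintegral_stateDensity_eq_one (fun x => by split_ifs <;> simp) (by simp) _ M.sigmaLat_sq_pos

lemma lintegral_fwdStep {k : ℕ} (hk : k < T) (u : State S V d) :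
    ∫⁻ w, M.fwdStep k u w ∂stateRef S V d = 1 :=
  lintegral_stateDensity_eq_one (M.xForward_nonneg (by omega) hk _) (M.sum_xForward _ _) _
    (M.sigma_sq_pos (by omega) hk)

lemma fst_eq_of_fwdInit_ne_zero {x₀ : TokSeq S V} {z : State S V d} (h : M.fwdInit x₀ z ≠ 0) :
    z.1 = x₀ := by
  by_contra hne
  simp [fwdInit, stateDensity, hne] at h

lemma fwdMulti_ne_zero {k : ℕ} {z₀ w : State S V d} (h : M.fwdMulti k z₀ w ≠ 0) :
    M.xMulti k z₀.1 w.1 ≠ 0 := fun h0 => by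
  simp [fwdMulti, stateDensity, h0] at h

lemma fwdMulti_mul_fwdStep {k : ℕ} (h1 : 1 ≤ k) (hk : k < T) {z₀ : State S V d}
    (hz₀ : ∀ i, z₀.1 i ≠ mask V) (u w : State S V d) :
    M.fwdMulti k z₀ u * M.fwdStep k u w = M.fwdMulti (k + 1) z₀ w * M.fwdBridge k z₀ w u := by
  have hx := M.xMulti_mul_xForward hk hz₀ u.1 w.1
  have hy := M.gaussDensity_mul_yForward h1 hk z₀.2 u.2 w.2
  rw [yForward] at hy
  simp only [fwdMulti, fwdStep, fwdBridge, stateDensity]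
  rw [mul_mul_mul_comm, ← ENNReal.ofReal_mul (M.xMulti_nonneg hk.le _ _), hx,
    ← ENNReal.ofReal_mul (gaussDensity_pos _ (M.sigmaBarSq_pos h1 hk.le) _).le, hy,
    ENNReal.ofReal_mul (M.xMulti_nonneg hk _ _),
    ENNReal.ofReal_mul (gaussDensity_pos _ (M.sigmaBarSq_pos (by omega) hk) _).le,
    mul_mul_mul_comm]

lemma isBridge {x₀ : TokSeq S V} (hx₀ : ∀ i, x₀ i ≠ mask V) :
    IsBridge (stateRef S V d) (M.fwdInit x₀) M.fwdStep M.fwdMulti M.fwdBridge T where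
  measurable_init := M.measurable_fwdInit x₀
  measurable_step := M.measurable_fwdStep
  measurable_multi := M.measurable_fwdMulti
  measurable_bridge := M.measurable_fwdBridge
  multi_one z₀ _ u := by
    simp [fwdMulti, fwdStep, funext (M.xMulti_one z₀.1), alphaBar, sigmaBarSq]
  bayes k h1 hk z₀ h0 u w := by
    obtain rfl := M.fst_eq_of_fwdInit_ne_zero h0
    exact M.fwdMulti_mul_fwdStep h1 hk hx₀ u w
  lintegral_bridge k h1 hk z₀ h0 w hw := by
    obtain rfl := M.fst_eq_of_fwdInit_ne_zero h0
    exact lintegral_stateDensity_eq_one (M.xBridge_nonneg hk _ _)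
      (M.sum_xBridge hk hx₀ (M.fwdMulti_ne_zero hw)) _ (M.bridgeVar_pos h1 hk)

end Model

/-! ### Expectations under the forward process -/

lemma lintegral_const_add {Ω : Type*} [MeasurableSpace Ω] {P : Measure Ω} [IsProbabilityMeasure P]
    (c : ℝ≥0∞) (h : Ω → ℝ≥0∞) : ∫⁻ z, c + h z ∂P = c + ∫⁻ z, h z ∂P := by
  rw [lintegral_add_left measurable_const, lintegral_const, measure_univ, mul_one]

namespace Model

variable {S V d T : ℕ} (M : Model S V d T)

lemma condForwardLaw_eq (x₀ : TokSeq S V) : M.condForwardLaw x₀ =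
    (pathRef S V d T).withDensity fun z => M.fwdInit x₀ (z 0) * pathProd M.fwdStep T z := by
  unfold condForwardLaw encoder yForward
  congr with z : 1
  rw [ENNReal.ofReal_mul (mul_nonneg (by split_ifs <;> simp)
      (gaussDensity_pos _ M.sigmaLat_sq_pos _).le), ENNReal.ofReal_prod_of_nonneg fun k _ =>
    mul_nonneg (M.xForward_nonneg (by omega) (by omega) _ _)
      (gaussDensity_pos _ (M.sigma_sq_pos (by omega) (by omega)) _).le]
  congr 1
  · rw [fwdInit, stateDensity_eq_ofReal fun x => by split_ifs <;> simp]
    split_ifs with h <;> simp [h]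
  · exact Finset.prod_congr rfl fun k _ =>
      (stateDensity_eq_ofReal (M.xForward_nonneg (by omega) (by omega) _) _ _ _).symm

lemma measurable_fwdDensity (x₀ : TokSeq S V) : Measurable
    fun z : Path S V d T => M.fwdInit x₀ (z 0) * pathProd M.fwdStep T z := by
  have := M.measurable_fwdInit x₀
  have := measurable_pathProd M.measurable_fwdStep T
  fun_prop

lemma lintegral_condForwardLaw (x₀ : TokSeq S V) {H : Path S V d T → ℝ≥0∞} (hH : Measurable H) :
    ∫⁻ z, H z ∂M.condForwardLaw x₀ =
      ∫⁻ z, M.fwdInit x₀ (z 0) * pathProd M.fwdStep T z * H z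
        ∂(Measure.pi fun _ => stateRef S V d) := by
  rw [condForwardLaw_eq, lintegral_withDensity_eq_lintegral_mul _ (M.measurable_fwdDensity x₀) hH]
  rfl

lemma lintegral_condForwardLaw_restrict (x₀ : TokSeq S V) {n : ℕ} (hn : n ≤ T)
    {H : (Fin (n + 1) → State S V d) → ℝ≥0∞} (hH : Measurable H) :
    ∫⁻ z, H (fun j => z (Fin.castLE (by omega) j)) ∂M.condForwardLaw x₀ =
      ∫⁻ z, M.fwdInit x₀ (z 0) * pathProd M.fwdStep n z * H z
        ∂(Measure.pi fun _ => stateRef S V d) := by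
  rw [lintegral_condForwardLaw _ _ (by fun_prop)]
  exact lintegral_path_restrict _ (M.measurable_fwdInit x₀) M.measurable_fwdStep hn
    (fun k _ hk u => M.lintegral_fwdStep hk u) hH

lemma at_eq (z : Path S V d T) {t : ℕ} (ht : t < T + 1) : at_ z t = z ⟨t, ht⟩ :=
  congrArg z (Fin.ext (Nat.mod_eq_of_lt ht))

@[fun_prop]
lemma measurable_at (t : ℕ) : Measurable fun z : Path S V d T => at_ z t :=
  measurable_pi_apply _

lemma lintegral_condForwardLaw_init (x₀ : TokSeq S V) {h : State S V d → ℝ≥0∞}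
    (hh : Measurable h) : ∫⁻ z, h (at_ z 0) ∂M.condForwardLaw x₀ =
      ∫⁻ z, M.fwdInit x₀ z * h z ∂stateRef S V d :=
  (M.lintegral_condForwardLaw_restrict x₀ (Nat.zero_le T) (H := fun z => h (z 0))
    (by fun_prop)).trans (by
      simpa [pathProd] using lintegral_path_zero (stateRef S V d) fun z => M.fwdInit x₀ z * h z)

instance isProbabilityMeasure_condForwardLaw (x₀ : TokSeq S V) :
    IsProbabilityMeasure (M.condForwardLaw x₀) := by
  constructor
  rw [← lintegral_one, M.lintegral_condForwardLaw_init x₀ (h := fun _ => 1) measurable_const]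
  simpa using M.lintegral_fwdInit x₀

lemma ae_fst_at_zero_eq (x₀ : TokSeq S V) : ∀ᵐ z ∂M.condForwardLaw x₀, (z 0).1 = x₀ := by
  rw [condForwardLaw_eq, ae_withDensity_iff (M.measurable_fwdDensity x₀)]
  exact ae_of_all _ fun z hz => M.fst_eq_of_fwdInit_ne_zero (left_ne_zero_of_mul hz)

variable {x₀ : TokSeq S V} (hx₀ : ∀ i, x₀ i ≠ mask V) {n : ℕ}

include hx₀

lemma lintegral_condForwardLaw_at (hn : n < T) {h : State S V d → State S V d → ℝ≥0∞}
    (hh : Measurable fun p : State S V d × State S V d => h p.1 p.2) :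
    ∫⁻ z, h (at_ z 0) (at_ z (n + 1)) ∂M.condForwardLaw x₀ =
      ∫⁻ z₀, M.fwdInit x₀ z₀ * ∫⁻ w, M.fwdMulti (n + 1) z₀ w * h z₀ w
        ∂stateRef S V d ∂stateRef S V d := by
  rw [← (M.isBridge hx₀).lintegral_path_last hn hh, ← M.lintegral_condForwardLaw_restrict x₀ hn
    (H := fun z => h (z 0) (z (Fin.last _))) (by fun_prop)]
  refine lintegral_congr fun z => ?_
  rw [at_eq z (by omega), at_eq z (show n + 1 < T + 1 by omega)]
  rfl

lemma lintegral_condForwardLaw_bridge (hn : n + 1 < T)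
    {h : State S V d → State S V d → State S V d → ℝ≥0∞}
    (hh : Measurable fun p : State S V d × State S V d × State S V d => h p.1 p.2.1 p.2.2)
    {g : State S V d → State S V d → ℝ≥0∞}
    (hg : Measurable fun p : State S V d × State S V d => g p.1 p.2)
    (hgh : ∀ z₀ w, z₀.1 = x₀ → M.xMulti (n + 2) z₀.1 w.1 ≠ 0 →
      ∫⁻ u, M.fwdBridge (n + 1) z₀ w u * h z₀ u w ∂stateRef S V d = g z₀ w) :
    ∫⁻ z, h (at_ z 0) (at_ z (n + 1)) (at_ z (n + 2)) ∂M.condForwardLaw x₀ =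
      ∫⁻ z, g (at_ z 0) (at_ z (n + 2)) ∂M.condForwardLaw x₀ := by
  calc ∫⁻ z, h (at_ z 0) (at_ z (n + 1)) (at_ z (n + 2)) ∂M.condForwardLaw x₀
      = ∫⁻ z₀, M.fwdInit x₀ z₀ * ∫⁻ w, M.fwdMulti (n + 2) z₀ w *
          ∫⁻ u, M.fwdBridge (n + 1) z₀ w u * h z₀ u w
            ∂stateRef S V d ∂stateRef S V d ∂stateRef S V d := by
        rw [← (M.isBridge hx₀).lintegral_path_last_two hn hh,
          ← M.lintegral_condForwardLaw_restrict x₀ hn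
            (H := fun z => h (z 0) (z (Fin.last _).castSucc) (z (Fin.last _))) (by fun_prop)]
        refine lintegral_congr fun z => ?_
        rw [at_eq z (by omega), at_eq z (show n + 1 < T + 1 by omega),
          at_eq z (show n + 2 < T + 1 by omega)]
        rfl
    _ = ∫⁻ z₀, M.fwdInit x₀ z₀ * ∫⁻ w, M.fwdMulti (n + 2) z₀ w * g z₀ w
          ∂stateRef S V d ∂stateRef S V d :=
        lintegral_mul_congr fun z₀ h0 => lintegral_mul_congr fun w hw =>
          hgh z₀ w (M.fst_eq_of_fwdInit_ne_zero h0) (M.fwdMulti_ne_zero hw)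
    _ = ∫⁻ z, g (at_ z 0) (at_ z (n + 2)) ∂M.condForwardLaw x₀ :=
        (M.lintegral_condForwardLaw_at hx₀ hn hg).symm

end Model

/-! ### Marginals of the forward process -/

lemma tokForward_comp {V : ℕ} (g h : ℝ) (x w : Tok V) :
    ∑ u, tokForward g x u * tokForward h u w = tokForward (g * h) x w := by
  by_cases hx : x = mask V
  · simp only [tokForward, if_pos hx, oneHot, ite_mul, one_mul, zero_mul, Finset.sum_ite_eq',
      Finset.mem_univ, if_true]
  · simp only [tokForward, if_neg hx, add_mul, Finset.sum_add_distrib, mul_assoc,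
      ← Finset.mul_sum]
    simp only [oneHot, ite_mul, one_mul, zero_mul, Finset.sum_ite_eq', Finset.mem_univ, if_true,
      if_neg hx]
    ring

namespace Model

variable {S V d T : ℕ} (M : Model S V d T)

lemma yMarginal_eq {t : ℕ} (h1 : 1 ≤ t) (ht : t ≤ T) (y : Latent d) :
    M.yMarginal t y = gaussLaw (M.alphaBar t • y) (M.sigmaBarSq t) := by
  induction t, h1 using Nat.le_induction with
  | base =>
    rw [yMarginal, yMarginal, Measure.dirac_bind (measurable_gaussLaw_smul _ _)]
    simp [alphaBar, sigmaBarSq]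
  | succ t h1 ih =>
    rw [yMarginal, ih (by omega), gaussLaw_bind _ _ (M.sigmaBarSq_pos h1 (by omega))
      (M.sigma_sq_pos (by omega) ht), smul_smul, alphaBar_succ, mul_comm, sigmaBarSq]

lemma xMulti_zero (x w : TokSeq S V) : M.xMulti 0 x w = if w = x then 1 else 0 := by
  simp only [xMulti, gamBar_zero, tokForward_one, oneHot, Finset.prod_ite_zero, funext_iff,
    Finset.mem_univ, true_imp_iff, Finset.prod_const_one]

lemma xMulti_comp (t : ℕ) (x w : TokSeq S V) :
    ∑ u, M.xMulti t x u * M.xForward (t + 1) u w = M.xMulti (t + 1) x w := by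
  simp only [xMulti, xForward, ← Finset.prod_mul_distrib, gamBar_succ, ← tokForward_comp]
  exact (Fintype.prod_sum fun i v =>
    tokForward (M.gamBar t) (x i) v * tokForward (M.gam (t + 1)) v (w i)).symm

lemma xMarginal_singleton {t : ℕ} (ht : t ≤ T) (x w : TokSeq S V) :
    M.xMarginal t x {w} = ENNReal.ofReal (M.xMulti t x w) := by
  induction t generalizing w with
  | zero =>
    rw [xMarginal, Measure.dirac_apply' _ (measurableSet_singleton _), xMulti_zero]
    split_ifs with h <;> simp [h, Ne.symm]
  | succ t ih =>
    rw [xMarginal, Measure.bind_apply (measurableSet_singleton _)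
      Measurable.of_discrete.aemeasurable, lintegral_fintype]
    simp only [withDensity_apply _ (measurableSet_singleton _), lintegral_singleton,
      Measure.count_singleton, mul_one, ih (by omega)]
    have hnonneg (u : TokSeq S V) : 0 ≤ M.xMulti t x u * M.xForward (t + 1) u w :=
      mul_nonneg (M.xMulti_nonneg (by omega) _ _) (M.xForward_nonneg (by omega) ht _ _)
    rw [← xMulti_comp, ENNReal.ofReal_sum_of_nonneg fun u _ => hnonneg u]
    refine Finset.sum_congr rfl fun u _ => ?_
    rw [mul_comm, ENNReal.ofReal_mul (M.xMulti_nonneg (by omega) _ _)]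

lemma xMarginal_last (x : TokSeq S V) : M.xMarginal T x = Measure.dirac fun _ => mask V := by
  refine Measure.ext_of_singleton fun w => ?_
  rw [M.xMarginal_singleton le_rfl, xMulti_last,
    Measure.dirac_apply' _ (measurableSet_singleton _)]
  split_ifs with h <;> simp [h, eq_comm]

lemma lossXT_eq_zero : M.lossXT = 0 := by
  simp [lossXT, xMarginal_last]

lemma lossYT_eq : M.lossYT =
    ∫⁻ z, gaussEnergy 0 (M.sigmaBarSq T) (M.alphaBar T • (at_ z 0).2) ∂M.forwardLaw := by
  simp_rw [lossYT, M.yMarginal_eq M.one_le_horizon le_rfl,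
    klDiv_gaussLaw _ _ (M.sigmaBarSq_pos M.one_le_horizon le_rfl)]

/-! ### The generative process -/

lemma xDen_le_one (t : ℕ) (z : State S V d) (i : Fin S) (v : Tok V) : M.xDen t z i v ≤ 1 := by
  rw [← M.xDen_sum t z i]
  exact Finset.single_le_sum (f := fun v => M.xDen t z i v) (fun v _ => M.xDen_nonneg t z i v)
    (Finset.mem_univ v)

lemma xReverse_nonneg {k : ℕ} (hk : k < T) (z : State S V d) (x : TokSeq S V) :
    0 ≤ M.xReverse (k + 1) z x :=
  Finset.prod_nonneg fun _ _ => tokBridge_nonneg (M.gamBar_succ_le hk) (M.gamBar_le_one hk.le) _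
    (M.xDen_nonneg _ _ _) _

lemma xReverse_le_one {k : ℕ} (hk : k < T) (z : State S V d) (x : TokSeq S V) :
    M.xReverse (k + 1) z x ≤ 1 :=
  Finset.prod_le_one (fun _ _ => tokBridge_nonneg (M.gamBar_succ_le hk) (M.gamBar_le_one hk.le) _
    (M.xDen_nonneg _ _ _) _) fun _ _ => tokBridge_le_one (M.gamBar_succ_le hk)
      (M.gamBar_le_one hk.le) _ (M.xDen_nonneg _ _ _) (M.xDen_sum _ _ _) _

@[fun_prop]
lemma measurable_xReverse {A : Type*} [MeasurableSpace A] (t : ℕ) {z : A → State S V d}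
    {x : A → TokSeq S V} (hz : Measurable z) (hx : Measurable x) :
    Measurable fun a => M.xReverse t (z a) (x a) := by
  refine (measurable_from_prod_countable_left (f := fun q : State S V d × TokSeq S V =>
    M.xReverse t q.1 q.2) fun x => ?_).comp (hz.prodMk hx)
  refine Finset.measurable_prod _ fun i _ => ?_
  have hi : Measurable fun z : State S V d => z.1 i := by fun_prop
  have hp := M.xDen_measurable t i (x i)
  dsimp only
  have ho : Measurable fun v : Tok V => oneHot v (x i) := .of_discrete
  exact Measurable.ite (hi (measurableSet_singleton _)) (by fun_prop) (ho.comp hi)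

@[fun_prop]
lemma measurable_yDen {A : Type*} [MeasurableSpace A] (t : ℕ) {z : A → State S V d}
    (hz : Measurable z) : Measurable fun a => M.yDen t (z a) := (M.yDen_measurable t).comp hz

/-- The mean of the latent at time `t - 1` under the reverse transition from `z`. -/
def revMean (t : ℕ) (z : State S V d) : Latent d :=
  if t = 1 then M.yDen 1 z else M.bridgeMean t z.2 (M.yDen t z)

/-- The variance of the latent at time `t - 1` under the reverse transition. -/
def revVar (t : ℕ) : ℝ := if t = 1 then M.sigmaLat ^ 2 else M.bridgeVar t

lemma yReverse_eq (t : ℕ) (z : State S V d) (y : Latent d) :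
    M.yReverse t z y = gaussDensity (M.revMean t z) (M.revVar t) y := by
  unfold yReverse revMean revVar; split_ifs <;> rfl

lemma revVar_pos {k : ℕ} (hk : k < T) : 0 < M.revVar (k + 1) := by
  unfold revVar; split_ifs with h
  · exact M.sigmaLat_sq_pos
  · exact M.bridgeVar_pos (by omega) hk

/-- The density of `Z_k` given `Z_{k+1} = w` under the generative process. -/
def revStep (k : ℕ) (w : State S V d) : State S V d → ℝ≥0∞ :=
  stateDensity (M.xReverse (k + 1) w) (M.revMean (k + 1) w) (M.revVar (k + 1))

/-- The density of `Z_T` under the generative process. -/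
def modelInit : State S V d → ℝ≥0∞ :=
  stateDensity (fun x => if x = (fun _ => mask V) then 1 else 0) 0 (M.sigmaBarSq T)

/-- Masked tokens occur only at times at which masking has started; this keeps the reverse token
transitions away from the division by zero in their definition. -/
def Reachable (k : ℕ) (w : State S V d) : Prop := ∀ i, w.1 i = mask V → M.gamBar k < 1

lemma measurable_revStep (k : ℕ) :
    Measurable fun p : State S V d × State S V d => M.revStep k p.1 p.2 := by
  have hm : Measurable (M.revMean (k + 1)) := by
    unfold revMean; split_ifs <;> fun_prop
  unfold revStep; fun_prop

lemma measurable_modelInit : Measurable M.modelInit := by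
  unfold modelInit; fun_prop

lemma lintegral_revStep {k : ℕ} (hk : k < T) {w : State S V d} (hw : M.Reachable (k + 1) w) :
    ∫⁻ u, M.revStep k w u ∂stateRef S V d = 1 :=
  lintegral_stateDensity_eq_one (M.xReverse_nonneg hk w)
    (sum_prod_eq_one fun i => sum_tokBridge (M.xDen_sum _ _ _) (hw i)) _ (M.revVar_pos hk)

lemma lintegral_modelInit : ∫⁻ w, M.modelInit w ∂stateRef S V d = 1 :=
  lintegral_stateDensity_eq_one (fun x => by split_ifs <;> simp) (by simp) _
    (M.sigmaBarSq_pos M.one_le_horizon le_rfl)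

lemma xReverse_eq_zero {k : ℕ} (hk : M.gamBar k = 1) (w : State S V d) {x : TokSeq S V}
    {i : Fin S} (hi : x i = mask V) : M.xReverse (k + 1) w x = 0 := by
  refine Finset.prod_eq_zero (Finset.mem_univ i) ?_
  rw [Nat.add_sub_cancel, hk, hi]
  unfold tokBridge
  split_ifs with hw
  · simp [M.xDen_mask]
  · simp [oneHot, Ne.symm hw]

lemma reachable_of_revStep_ne_zero {k : ℕ} (hk : k < T) {w u : State S V d}
    (h : M.revStep k w u ≠ 0) : M.Reachable k u := fun i hi =>
  lt_of_le_of_ne (M.gamBar_le_one hk.le) fun h1 => h <| by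
    simp [revStep, stateDensity, M.xReverse_eq_zero h1 w hi]

lemma modelLaw_eq : M.modelLaw = (pathRef S V d T).withDensity fun z =>
    M.modelInit (z (Fin.last T)) * pathProd (fun k u w => M.revStep k w u) T z := by
  have hσ := M.sigmaBarSq_pos M.one_le_horizon le_rfl
  unfold modelLaw
  congr with z : 1
  rw [ENNReal.ofReal_mul (mul_nonneg (by split_ifs <;> simp) (gaussDensity_pos _ hσ _).le),
    ENNReal.ofReal_prod_of_nonneg fun k _ => mul_nonneg (M.xReverse_nonneg k.2 _ _)
      (by rw [yReverse_eq]; exact (gaussDensity_pos _ (M.revVar_pos k.2) _).le)]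
  congr 1
  · rw [modelInit, stateDensity_eq_ofReal fun x => by split_ifs <;> simp]
  · refine Finset.prod_congr rfl fun k _ => ?_
    rw [yReverse_eq]
    exact (stateDensity_eq_ofReal (M.xReverse_nonneg k.2 _) _ _ _).symm

lemma measurable_modelDensity : Measurable fun z : Path S V d T =>
    M.modelInit (z (Fin.last T)) * pathProd (fun k u w => M.revStep k w u) T z := by
  have := M.measurable_modelInit
  have := M.measurable_revStep
  have := measurable_pathProd (F := fun k u w => M.revStep k w u) (by fun_prop) T
  fun_prop

instance isProbabilityMeasure_modelLaw : IsProbabilityMeasure M.modelLaw := by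
  constructor
  rw [modelLaw_eq, withDensity_apply _ MeasurableSet.univ, Measure.restrict_univ]
  refine (lintegral_path_backward _ M.measurable_revStep M.Reachable
    (fun k hk w _ u h => M.reachable_of_revStep_ne_zero hk h)
    (fun k hk w hw => M.lintegral_revStep hk hw) M.measurable_modelInit ?_).trans
    M.lintegral_modelInit
  intro w _ i _
  rw [gamBar_last]; exact zero_lt_one

end Model

/-! ### Comparison of the two path densities -/

lemma stateDensity_mul_expNeg_gaussEnergy {S V d : ℕ} (p : TokSeq S V → ℝ) (μ c : Latent d)
    {v : ℝ} (hv : 0 < v) (z : State S V d) :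
    stateDensity p c v z * expNeg (gaussEnergy μ v z.2) =
      stateDensity p μ v z * expNeg (gaussEnergy c v z.2) := by
  rw [stateDensity, mul_assoc, gaussDensity_mul_expNeg_gaussEnergy μ c z.2 hv, ← mul_assoc,
    stateDensity]

namespace Model

variable {S V d T : ℕ} (M : Model S V d T)

/-- The negative log-likelihood, under the denoiser at time `k + 1`, of the tokens of `x₀` at the
positions that get unmasked when moving from `w` to the tokens `u`. -/
def unmaskCost (k : ℕ) (x₀ : TokSeq S V) (w : State S V d) (u : TokSeq S V) : ℝ≥0∞ :=
  ∑ i, if w.1 i = mask V ∧ u i ≠ mask V then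
    negLog (ENNReal.ofReal (M.xDen (k + 1) w i (x₀ i))) else 0

/-- The Gaussian energy of the latent of `u` at time `k` for the bridge from the latent of `w` at
time `k + 1` to the clean latent `c`. -/
def bridgeEnergy (k : ℕ) (c : Latent d) (w u : State S V d) : ℝ≥0∞ :=
  gaussEnergy (M.bridgeMean (k + 1) w.2 c) (M.bridgeVar (k + 1)) u.2

/-- The Gaussian energy of the latent channel of a path under the forward process given
`X_0 = x₀`, factored as the encoder, the law of `Y_T` given `Y_0` and the bridges. -/
def fwdEnergy (x₀ : TokSeq S V) (z : Path S V d T) : ℝ≥0∞ :=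
  gaussEnergy (M.encMean x₀) (M.sigmaLat ^ 2) (at_ z 0).2 +
    gaussEnergy (M.alphaBar T • (at_ z 0).2) (M.sigmaBarSq T) (at_ z T).2 +
    ∑ k ∈ Finset.Ico 1 T, M.bridgeEnergy k (at_ z 0).2 (at_ z (k + 1)) (at_ z k)

/-- The energy of a path under the generative process, relative to the forward token transitions
given `X_0 = x₀`. -/
def modelEnergy (x₀ : TokSeq S V) (z : Path S V d T) : ℝ≥0∞ :=
  gaussEnergy (M.yDen 1 (at_ z 1)) (M.sigmaLat ^ 2) (at_ z 0).2 +
    negLog (ENNReal.ofReal (M.xReverse 1 (at_ z 1) (at_ z 0).1)) +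
    gaussEnergy 0 (M.sigmaBarSq T) (at_ z T).2 +
    ∑ k ∈ Finset.Ico 1 T,
      (M.bridgeEnergy k (M.yDen (k + 1) (at_ z (k + 1))) (at_ z (k + 1)) (at_ z k) +
        M.unmaskCost k x₀ (at_ z (k + 1)) (at_ z k).1)

@[fun_prop]
lemma measurable_bridgeEnergy {A : Type*} [MeasurableSpace A] (k : ℕ) {c : A → Latent d}
    {w u : A → State S V d} (hc : Measurable c) (hw : Measurable w) (hu : Measurable u) :
    Measurable fun a => M.bridgeEnergy k (c a) (w a) (u a) := by
  unfold bridgeEnergy; fun_prop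

@[fun_prop]
lemma measurable_unmaskCost {A : Type*} [MeasurableSpace A] (k : ℕ) (x₀ : TokSeq S V)
    {w : A → State S V d} {u : A → TokSeq S V} (hw : Measurable w) (hu : Measurable u) :
    Measurable fun a => M.unmaskCost k x₀ (w a) (u a) := by
  refine Finset.measurable_sum _ fun i _ =>
    Measurable.ite (.inter ?_ (.compl ?_)) ?_ measurable_const
  · exact (by fun_prop : Measurable fun a => (w a).1 i) (measurableSet_singleton _)
  · exact (by fun_prop : Measurable fun a => u a i) (measurableSet_singleton _)
  · exact measurable_negLog.comp ((M.xDen_measurable (k + 1) i (x₀ i)).comp hw).ennreal_ofReal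

lemma measurable_fwdEnergy (x₀ : TokSeq S V) : Measurable (M.fwdEnergy x₀) := by
  unfold fwdEnergy; fun_prop

lemma measurable_modelEnergy (x₀ : TokSeq S V) : Measurable (M.modelEnergy x₀) := by
  unfold modelEnergy; fun_prop

lemma pathProd_eq_prod_range (F : ℕ → State S V d → State S V d → ℝ≥0∞) (z : Path S V d T) :
    pathProd F T z = ∏ k ∈ Finset.range T, F k (at_ z k) (at_ z (k + 1)) := by
  rw [← Fin.prod_univ_eq_prod_range (fun k => F k (at_ z k) (at_ z (k + 1)))]
  refine Finset.prod_congr rfl fun k _ => ?_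
  rw [at_eq z (by omega), at_eq z (show (k : ℕ) + 1 < T + 1 by omega)]
  rfl

lemma at_last (z : Path S V d T) : at_ z T = z (Fin.last T) := at_eq z (Nat.lt_succ_self T)

lemma ofReal_xReverse_eq {k : ℕ} (hk : k < T) {x₀ : TokSeq S V} (hx₀ : ∀ i, x₀ i ≠ mask V)
    {w : State S V d} {u : TokSeq S V} (h : M.xBridge k x₀ w.1 u ≠ 0) :
    ENNReal.ofReal (M.xReverse (k + 1) w u) =
      ENNReal.ofReal (M.xBridge k x₀ w.1 u) * expNeg (M.unmaskCost k x₀ w u) := by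
  have htok (i : Fin S) := tokBridge_eq_oneHot_mul (hx₀ i) (M.xDen_mask (k + 1) w i)
    (Finset.prod_ne_zero_iff.1 h i (Finset.mem_univ i))
  have hprod : M.xReverse (k + 1) w u = M.xBridge k x₀ w.1 u *
      ∏ i, if w.1 i = mask V ∧ u i ≠ mask V then M.xDen (k + 1) w i (x₀ i) else 1 := by
    rw [xReverse, xBridge, ← Finset.prod_mul_distrib]
    exact Finset.prod_congr rfl fun i _ => htok i
  rw [hprod, ENNReal.ofReal_mul (M.xBridge_nonneg hk x₀ w.1 u), unmaskCost, expNeg_sum,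
    ENNReal.ofReal_prod_of_nonneg fun i _ => by split_ifs <;> simp [M.xDen_nonneg]]
  congr 1
  refine Finset.prod_congr rfl fun i _ => ?_
  split_ifs
  · rw [expNeg_negLog (ENNReal.ofReal_le_one.2 (M.xDen_le_one _ _ _ _))]
  · simp

lemma modelInit_mul_expNeg (x₀ : TokSeq S V) (y₀ : Latent d) (w : State S V d) :
    M.modelInit w * expNeg (gaussEnergy (M.alphaBar T • y₀) (M.sigmaBarSq T) w.2) =
      M.fwdMulti T (x₀, y₀) w * expNeg (gaussEnergy 0 (M.sigmaBarSq T) w.2) := by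
  rw [modelInit, stateDensity_mul_expNeg_gaussEnergy _ _ _
    (M.sigmaBarSq_pos M.one_le_horizon le_rfl), fwdMulti, funext (M.xMulti_last x₀)]

lemma revStep_zero_mul_expNeg (w u : State S V d) :
    M.revStep 0 w u * expNeg (gaussEnergy (M.encMean u.1) (M.sigmaLat ^ 2) u.2) =
      M.fwdInit u.1 u * expNeg (gaussEnergy (M.yDen 1 w) (M.sigmaLat ^ 2) u.2 +
        negLog (ENNReal.ofReal (M.xReverse 1 w u.1))) := by
  have hle : ENNReal.ofReal (M.xReverse 1 w u.1) ≤ 1 :=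
    ENNReal.ofReal_le_one.2 (M.xReverse_le_one M.one_le_horizon w u.1)
  rw [expNeg_add, expNeg_negLog hle, revStep, revMean, revVar, if_pos rfl, if_pos rfl, zero_add,
    stateDensity_mul_expNeg_gaussEnergy _ _ _ M.sigmaLat_sq_pos, fwdInit, stateDensity,
    stateDensity, if_pos rfl, ENNReal.ofReal_one]
  ring

lemma revStep_mul_expNeg {k : ℕ} (h1 : 1 ≤ k) (hk : k < T) {z₀ : State S V d}
    (hx₀ : ∀ i, z₀.1 i ≠ mask V) {w u : State S V d} (h : M.fwdBridge k z₀ w u ≠ 0) :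
    M.revStep k w u * expNeg (M.bridgeEnergy k z₀.2 w u) =
      M.fwdBridge k z₀ w u * expNeg (M.bridgeEnergy k (M.yDen (k + 1) w) w u +
        M.unmaskCost k z₀.1 w u.1) := by
  have hx : M.xBridge k z₀.1 w.1 u.1 ≠ 0 := fun h0 => h (by simp [fwdBridge, stateDensity, h0])
  rw [expNeg_add, revStep, revMean, revVar, if_neg (by omega), if_neg (by omega), bridgeEnergy,
    stateDensity_mul_expNeg_gaussEnergy _ _ _ (M.bridgeVar_pos h1 hk), stateDensity,
    M.ofReal_xReverse_eq hk hx₀ hx, fwdBridge, stateDensity, bridgeEnergy]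
  ring

lemma fwdDensity_eq {x₀ : TokSeq S V} (hx₀ : ∀ i, x₀ i ≠ mask V) (z : Path S V d T)
    (h : M.fwdInit x₀ (at_ z 0) ≠ 0) :
    M.fwdInit x₀ (z 0) * pathProd M.fwdStep T z =
      M.fwdInit x₀ (at_ z 0) * (M.fwdMulti T (at_ z 0) (at_ z T) *
        ∏ k ∈ Finset.Ico 1 T, M.fwdBridge k (at_ z 0) (at_ z (k + 1)) (at_ z k)) := by
  obtain ⟨n, rfl⟩ : ∃ n, T = n + 1 := ⟨T - 1, by have := M.one_le_horizon; omega⟩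
  rw [pathProd_eq_prod_range, (M.isBridge hx₀).prod_step_eq n.lt_succ_self h]
  rfl

lemma modelDensity_eq (z : Path S V d T) :
    M.modelInit (z (Fin.last T)) * pathProd (fun k u w => M.revStep k w u) T z =
      M.modelInit (at_ z T) * (M.revStep 0 (at_ z 1) (at_ z 0) *
        ∏ k ∈ Finset.Ico 1 T, M.revStep k (at_ z (k + 1)) (at_ z k)) := by
  rw [pathProd_eq_prod_range, at_last, Finset.range_eq_Ico,
    Finset.prod_eq_prod_Ico_succ_bot M.one_le_horizon]

theorem modelDensity_mul_expNeg {x₀ : TokSeq S V} (hx₀ : ∀ i, x₀ i ≠ mask V) (z : Path S V d T)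
    (h : M.fwdInit x₀ (z 0) * pathProd M.fwdStep T z ≠ 0) :
    M.modelInit (z (Fin.last T)) * pathProd (fun k u w => M.revStep k w u) T z *
        expNeg (M.fwdEnergy x₀ z) =
      M.fwdInit x₀ (z 0) * pathProd M.fwdStep T z * expNeg (M.modelEnergy x₀ z) := by
  have hinit : M.fwdInit x₀ (at_ z 0) ≠ 0 := left_ne_zero_of_mul h
  rw [M.fwdDensity_eq hx₀ z hinit] at h ⊢
  obtain rfl := M.fst_eq_of_fwdInit_ne_zero hinit
  have hbridges := right_ne_zero_of_mul (right_ne_zero_of_mul h)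
  have hlast := M.modelInit_mul_expNeg (at_ z 0).1 (at_ z 0).2 (at_ z T)
  have hfirst := M.revStep_zero_mul_expNeg (at_ z 1) (at_ z 0)
  have hmiddle : ∏ k ∈ Finset.Ico 1 T, (M.revStep k (at_ z (k + 1)) (at_ z k) *
        expNeg (M.bridgeEnergy k (at_ z 0).2 (at_ z (k + 1)) (at_ z k))) =
      ∏ k ∈ Finset.Ico 1 T, (M.fwdBridge k (at_ z 0) (at_ z (k + 1)) (at_ z k) *
        expNeg (M.bridgeEnergy k (M.yDen (k + 1) (at_ z (k + 1))) (at_ z (k + 1)) (at_ z k) +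
          M.unmaskCost k (at_ z 0).1 (at_ z (k + 1)) (at_ z k).1)) :=
    Finset.prod_congr rfl fun k hk => M.revStep_mul_expNeg (Finset.mem_Ico.1 hk).1
      (Finset.mem_Ico.1 hk).2 hx₀ (Finset.prod_ne_zero_iff.1 hbridges k hk)
  rw [Finset.prod_mul_distrib, Finset.prod_mul_distrib, ← expNeg_sum, ← expNeg_sum] at hmiddle
  calc _ = M.modelInit (at_ z T) *
          expNeg (gaussEnergy (M.alphaBar T • (at_ z 0).2) (M.sigmaBarSq T) (at_ z T).2) *
        (M.revStep 0 (at_ z 1) (at_ z 0) *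
          expNeg (gaussEnergy (M.encMean (at_ z 0).1) (M.sigmaLat ^ 2) (at_ z 0).2)) *
        ((∏ k ∈ Finset.Ico 1 T, M.revStep k (at_ z (k + 1)) (at_ z k)) * expNeg (∑ k ∈
          Finset.Ico 1 T, M.bridgeEnergy k (at_ z 0).2 (at_ z (k + 1)) (at_ z k))) := by
        rw [modelDensity_eq, fwdEnergy, expNeg_add, expNeg_add]; ring
    _ = _ := by
        rw [hlast, hfirst, hmiddle, modelEnergy, expNeg_add _ (∑ k ∈ _, _),
          expNeg_add _ (gaussEnergy 0 _ _)]; ring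

/-! ### The divergence of the forward path from the generative path -/

lemma lintegral_gaussEnergy_encMean (x₀ : TokSeq S V) :
    ∫⁻ z, gaussEnergy (M.encMean x₀) (M.sigmaLat ^ 2) (at_ z 0).2 ∂M.condForwardLaw x₀ =
      ENNReal.ofReal (d / 2) := by
  rw [M.lintegral_condForwardLaw_init x₀
    (h := fun z => gaussEnergy (M.encMean x₀) (M.sigmaLat ^ 2) z.2) (by fun_prop), fwdInit,
    lintegral_stateDensity_snd (fun x => by split_ifs <;> simp) (by simp) _ _ (by fun_prop),
    lintegral_gaussEnergy _ _ M.sigmaLat_sq_pos, gaussEnergy_self, add_zero]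

lemma gaussEnergy_bridgeMean {k : ℕ} (h1 : 1 ≤ k) (hk : k < T) (y c y₀ : Latent d) :
    gaussEnergy (M.bridgeMean (k + 1) y c) (M.bridgeVar (k + 1)) (M.bridgeMean (k + 1) y y₀) =
      ENNReal.ofReal (M.weightY (k + 1) * ‖y₀ - c‖ ^ 2) := by
  have hk_pos := M.sigmaBarSq_pos h1 hk.le
  have hsucc_pos := M.sigmaBarSq_pos (t := k + 1) (by omega) hk
  have hσ_pos := M.sigma_pos (k + 1) (by omega) hk
  have hsub : M.bridgeMean (k + 1) y y₀ - M.bridgeMean (k + 1) y c =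
      (M.alphaBar k * M.sigma (k + 1) ^ 2 / M.sigmaBarSq (k + 1)) • (y₀ - c) := by
    simp only [bridgeMean, Nat.add_sub_cancel]; module
  rw [gaussEnergy, hsub, norm_smul, mul_pow, Real.norm_eq_abs, sq_abs, bridgeVar, weightY,
    Nat.add_sub_cancel]
  congr 1
  field_simp

section

variable {x₀ : TokSeq S V} (hx₀ : ∀ i, x₀ i ≠ mask V)

include hx₀

lemma lintegral_gaussEnergy_last {c : Latent d → Latent d} (hc : Measurable c) :
    ∫⁻ z, gaussEnergy (c (at_ z 0).2) (M.sigmaBarSq T) (at_ z T).2 ∂M.condForwardLaw x₀ =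
      ENNReal.ofReal (d / 2) + ∫⁻ z, gaussEnergy (c (at_ z 0).2) (M.sigmaBarSq T)
        (M.alphaBar T • (at_ z 0).2) ∂M.condForwardLaw x₀ := by
  obtain ⟨n, hn⟩ : ∃ n, n + 1 = T := ⟨T - 1, by have := M.one_le_horizon; omega⟩
  have hlast := M.lintegral_condForwardLaw_at hx₀ (n := n) (by omega)
    (h := fun z₀ w => gaussEnergy (c z₀.2) (M.sigmaBarSq T) w.2) (by fun_prop)
  rw [hn] at hlast
  rw [hlast, ← lintegral_const_add, M.lintegral_condForwardLaw_init x₀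
    (h := fun z₀ => ENNReal.ofReal (d / 2) + gaussEnergy (c z₀.2) (M.sigmaBarSq T)
      (M.alphaBar T • z₀.2)) (by fun_prop)]
  refine lintegral_congr fun z₀ => ?_
  rw [fwdMulti, lintegral_stateDensity_snd (M.xMulti_nonneg le_rfl _)
    (sum_prod_eq_one fun _ => sum_tokForward _ _) _ _ (by fun_prop),
    lintegral_gaussEnergy _ _ (M.sigmaBarSq_pos M.one_le_horizon le_rfl)]

lemma lintegral_bridgeEnergy {k : ℕ} (h1 : 1 ≤ k) (hk : k < T)
    {c : State S V d → State S V d → Latent d}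
    (hc : Measurable fun p : State S V d × State S V d => c p.1 p.2) :
    ∫⁻ z, M.bridgeEnergy k (c (at_ z 0) (at_ z (k + 1))) (at_ z (k + 1)) (at_ z k)
        ∂M.condForwardLaw x₀ =
      ENNReal.ofReal (d / 2) + ∫⁻ z, ENNReal.ofReal (M.weightY (k + 1) *
        ‖(at_ z 0).2 - c (at_ z 0) (at_ z (k + 1))‖ ^ 2) ∂M.condForwardLaw x₀ := by
  obtain ⟨n, rfl⟩ : ∃ n, k = n + 1 := ⟨k - 1, by omega⟩
  have : Measurable fun p : State S V d × State S V d × State S V d => c p.1 p.2.2 :=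
    hc.comp (by fun_prop : Measurable fun p : State S V d × State S V d × State S V d =>
      (p.1, p.2.2))
  rw [← lintegral_const_add]
  refine M.lintegral_condForwardLaw_bridge hx₀ hk
    (h := fun z₀ u w => M.bridgeEnergy (n + 1) (c z₀ w) w u)
    (g := fun z₀ w => ENNReal.ofReal (d / 2) + ENNReal.ofReal (M.weightY (n + 2) *
      ‖z₀.2 - c z₀ w‖ ^ 2)) (by fun_prop) (by fun_prop) ?_
  rintro z₀ w rfl hw
  rw [← M.gaussEnergy_bridgeMean h1 hk w.2, ← lintegral_gaussEnergy _ _ (M.bridgeVar_pos h1 hk)]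
  exact lintegral_stateDensity_snd (M.xBridge_nonneg hk _ _) (M.sum_xBridge hk hx₀ hw) _ _
    (by fun_prop)

lemma lintegral_fwdEnergy : ∫⁻ z, M.fwdEnergy x₀ z ∂M.condForwardLaw x₀ =
    ENNReal.ofReal (d / 2) + ENNReal.ofReal (d / 2) +
      ∑ _k ∈ Finset.Ico 1 T, ENNReal.ofReal (d / 2) := by
  unfold fwdEnergy
  rw [lintegral_add_left (by fun_prop), lintegral_add_left (by fun_prop),
    M.lintegral_gaussEnergy_encMean, M.lintegral_gaussEnergy_last hx₀
      (c := fun y => M.alphaBar T • y) (by fun_prop), lintegral_finsetSum _ fun k _ => by fun_prop]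
  congr 1
  · simp [gaussEnergy_self]
  · refine Finset.sum_congr rfl fun k hk => ?_
    rw [Finset.mem_Ico] at hk
    rw [M.lintegral_bridgeEnergy hx₀ hk.1 hk.2 (c := fun z₀ _ => z₀.2) (by fun_prop)]
    simp

lemma lintegral_modelEnergy : ∫⁻ z, M.modelEnergy x₀ z ∂M.condForwardLaw x₀ =
    ∫⁻ z, gaussEnergy (M.yDen 1 (at_ z 1)) (M.sigmaLat ^ 2) (at_ z 0).2 ∂M.condForwardLaw x₀ +
      ∫⁻ z, negLog (ENNReal.ofReal (M.xReverse 1 (at_ z 1) (at_ z 0).1)) ∂M.condForwardLaw x₀ +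
      (ENNReal.ofReal (d / 2) + ∫⁻ z, gaussEnergy 0 (M.sigmaBarSq T) (M.alphaBar T • (at_ z 0).2)
        ∂M.condForwardLaw x₀) +
      ∑ k ∈ Finset.Ico 1 T, (ENNReal.ofReal (d / 2) +
        ∫⁻ z, ENNReal.ofReal (M.weightY (k + 1) *
          ‖(at_ z 0).2 - M.yDen (k + 1) (at_ z (k + 1))‖ ^ 2) ∂M.condForwardLaw x₀ +
        ∫⁻ z, M.unmaskCost k x₀ (at_ z (k + 1)) (at_ z k).1 ∂M.condForwardLaw x₀) := by
  unfold modelEnergy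
  rw [lintegral_add_left (by fun_prop), lintegral_add_left (by fun_prop),
    lintegral_add_left (by fun_prop), lintegral_finsetSum _ fun k _ => by fun_prop,
    M.lintegral_gaussEnergy_last hx₀ (c := fun _ => 0) measurable_const]
  congr 1
  refine Finset.sum_congr rfl fun k hk => ?_
  rw [Finset.mem_Ico] at hk
  rw [lintegral_add_left (by fun_prop), M.lintegral_bridgeEnergy hx₀ hk.1 hk.2
    (c := fun _ w => M.yDen (k + 1) w) (by fun_prop)]

theorem klDiv_condForwardLaw_add_dim :
    klDiv (M.condForwardLaw x₀) M.modelLaw + ENNReal.ofReal (d / 2) =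
      ∫⁻ z, gaussEnergy (M.yDen 1 (at_ z 1)) (M.sigmaLat ^ 2) (at_ z 0).2 ∂M.condForwardLaw x₀ +
      ∫⁻ z, negLog (ENNReal.ofReal (M.xReverse 1 (at_ z 1) (at_ z 0).1)) ∂M.condForwardLaw x₀ +
      ∫⁻ z, gaussEnergy 0 (M.sigmaBarSq T) (M.alphaBar T • (at_ z 0).2) ∂M.condForwardLaw x₀ +
      ∑ k ∈ Finset.Ico 1 T, (∫⁻ z, ENNReal.ofReal (M.weightY (k + 1) *
          ‖(at_ z 0).2 - M.yDen (k + 1) (at_ z (k + 1))‖ ^ 2) ∂M.condForwardLaw x₀ +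
        ∫⁻ z, M.unmaskCost k x₀ (at_ z (k + 1)) (at_ z k).1 ∂M.condForwardLaw x₀) := by
  have hN := M.lintegral_fwdEnergy hx₀
  have hL := M.lintegral_modelEnergy hx₀
  have hP : IsProbabilityMeasure (M.condForwardLaw x₀) := inferInstance
  have hQ : IsProbabilityMeasure M.modelLaw := inferInstance
  rw [condForwardLaw_eq] at hP
  rw [modelLaw_eq] at hQ
  have hfin : ENNReal.ofReal (d / 2) + ∑ _k ∈ Finset.Ico 1 T, ENNReal.ofReal (d / 2) ≠ ∞ := by
    simp [ENNReal.mul_eq_top]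
  have hkl := klDiv_withDensity_add_lintegral (M.measurable_fwdDensity x₀)
    M.measurable_modelDensity (M.measurable_modelEnergy x₀) (M.measurable_fwdEnergy x₀)
    (by rw [← condForwardLaw_eq, hN, add_assoc]; exact ENNReal.add_ne_top.2 ⟨by simp, hfin⟩)
    (M.modelDensity_mul_expNeg hx₀)
  rw [← condForwardLaw_eq, ← modelLaw_eq, hN, hL] at hkl
  simp only [add_assoc, Finset.sum_add_distrib] at hkl ⊢
  refine (ENNReal.add_right_inj hfin).1 (Eq.trans ?_ (hkl.trans ?_)) <;> ring

end

/-! ### The cost of the unmasked tokens -/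

lemma negLog_predProb (t : ℕ) (w : State S V d) (x : TokSeq S V) :
    negLog (ENNReal.ofReal (M.predProb t w x)) =
      ∑ i, negLog (ENNReal.ofReal (M.xDen t w i (x i))) := by
  rw [predProb, ENNReal.ofReal_prod_of_nonneg fun i _ => M.xDen_nonneg t w i (x i),
    negLog_prod _ fun i _ => ENNReal.ofReal_le_one.2 (M.xDen_le_one t w i (x i))]

@[fun_prop]
lemma measurable_predProb {A : Type*} [MeasurableSpace A] (t : ℕ) {w : A → State S V d}
    {x : A → TokSeq S V} (hw : Measurable w) (hx : Measurable x) :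
    Measurable fun a => M.predProb t (w a) (x a) :=
  (measurable_from_prod_countable_left (f := fun q : State S V d × TokSeq S V =>
    M.predProb t q.1 q.2) fun x => Finset.measurable_prod _ fun i _ =>
      M.xDen_measurable t i (x i)).comp (hw.prodMk hx)

/-- The negative log-likelihood, under the denoiser at time `t`, of the tokens of `x₀` at the
masked positions of `w`. -/
def maskedCost (t : ℕ) (x₀ : TokSeq S V) (w : State S V d) : ℝ≥0∞ :=
  ∑ i, if w.1 i = mask V then negLog (ENNReal.ofReal (M.xDen t w i (x₀ i))) else 0

lemma measurable_maskedCost (t : ℕ) (x₀ : TokSeq S V) : Measurable (M.maskedCost t x₀) := by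
  refine Finset.measurable_sum _ fun i _ => Measurable.ite ?_ ?_ measurable_const
  · exact (by fun_prop : Measurable fun w : State S V d => w.1 i) (measurableSet_singleton _)
  · exact measurable_negLog.comp (M.xDen_measurable t i (x₀ i)).ennreal_ofReal

lemma maskedCost_le (t : ℕ) (x₀ : TokSeq S V) (w : State S V d) :
    M.maskedCost t x₀ w ≤ negLog (ENNReal.ofReal (M.predProb t w x₀)) := by
  rw [negLog_predProb]
  exact Finset.sum_le_sum fun i _ => by split_ifs <;> simp

lemma eq_of_xMulti_ne_zero {t : ℕ} {x₀ x : TokSeq S V} (h : M.xMulti t x₀ x ≠ 0) {i : Fin S}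
    (hi : x i ≠ mask V) : x i = x₀ i := by
  contrapose! h
  refine Finset.prod_eq_zero (Finset.mem_univ i) ?_
  unfold tokForward
  split_ifs <;> simp [oneHot, hi, h]

lemma maskedCost_eq (hM : M.CarryOver) {t : ℕ} (h1 : 1 ≤ t) (ht : t ≤ T) {x₀ : TokSeq S V}
    {w : State S V d} (hw : M.xMulti t x₀ w.1 ≠ 0) :
    M.maskedCost t x₀ w = negLog (ENNReal.ofReal (M.predProb t w x₀)) := by
  rw [negLog_predProb]
  refine Finset.sum_congr rfl fun i _ => ?_
  split_ifs with hi
  · rfl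
  · rw [hM t h1 ht w i hi, M.eq_of_xMulti_ne_zero hw hi, oneHot_self, ENNReal.ofReal_one,
      negLog_one]

section

variable {x₀ : TokSeq S V} (hx₀ : ∀ i, x₀ i ≠ mask V) {k : ℕ}

include hx₀

lemma sum_xBridge_mul_unmaskCost (hk : k < T) {w : State S V d}
    (hw : M.xMulti (k + 1) x₀ w.1 ≠ 0) :
    ∑ u, ENNReal.ofReal (M.xBridge k x₀ w.1 u) * M.unmaskCost k x₀ w u =
      ENNReal.ofReal (-M.weightX (k + 1)) * M.maskedCost (k + 1) x₀ w := by
  have hnonneg (i : Fin S) (v : Tok V) :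
      0 ≤ tokBridge (M.gamBar k) (M.gamBar (k + 1)) (w.1 i) (oneHot (x₀ i)) v :=
    tokBridge_nonneg (M.gamBar_succ_le hk) (M.gamBar_le_one hk.le) _ (oneHot_nonneg _) v
  have hsum (i : Fin S) : ∑ v, ENNReal.ofReal
      (tokBridge (M.gamBar k) (M.gamBar (k + 1)) (w.1 i) (oneHot (x₀ i)) v) = 1 := by
    rw [← ENNReal.ofReal_sum_of_nonneg fun v _ => hnonneg i v, sum_tokBridge (sum_oneHot _)
      fun hi => M.gamBar_lt_one_of_xMulti_ne_zero (t := k + 1) hk hx₀ hw hi, ENNReal.ofReal_one]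
  simp_rw [xBridge, ENNReal.ofReal_prod_of_nonneg fun i _ => hnonneg i _, unmaskCost]
  rw [sum_prod_mul_sum (φ := fun i v => if w.1 i = mask V ∧ v ≠ mask V then
    negLog (ENNReal.ofReal (M.xDen (k + 1) w i (x₀ i))) else 0) hsum, maskedCost, Finset.mul_sum]
  refine Finset.sum_congr rfl fun i _ => ?_
  rw [sum_tokBridge_mul_unmask (hx₀ i), mul_ite, mul_zero, weightX, Nat.add_sub_cancel, ← neg_div,
    neg_sub]

lemma lintegral_unmaskCost (h1 : 1 ≤ k) (hk : k < T) {g : State S V d → ℝ≥0∞} (hg : Measurable g)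
    (h : ∀ w : State S V d, M.xMulti (k + 1) x₀ w.1 ≠ 0 →
      ENNReal.ofReal (-M.weightX (k + 1)) * M.maskedCost (k + 1) x₀ w = g w) :
    ∫⁻ z, M.unmaskCost k x₀ (at_ z (k + 1)) (at_ z k).1 ∂M.condForwardLaw x₀ =
      ∫⁻ z, g (at_ z (k + 1)) ∂M.condForwardLaw x₀ := by
  obtain ⟨n, rfl⟩ : ∃ n, k = n + 1 := ⟨k - 1, by omega⟩
  refine M.lintegral_condForwardLaw_bridge hx₀ hk
    (h := fun _ u w => M.unmaskCost (n + 1) x₀ w u.1) (g := fun _ w => g w)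
    (by fun_prop) (by fun_prop) ?_
  rintro z₀ w rfl hw
  rw [← h w hw, ← M.sum_xBridge_mul_unmaskCost hx₀ hk hw]
  exact lintegral_stateDensity_fst _ _ (M.bridgeVar_pos h1 hk) _

lemma lintegral_unmaskCost_le (h1 : 1 ≤ k) (hk : k < T) :
    ∫⁻ z, M.unmaskCost k x₀ (at_ z (k + 1)) (at_ z k).1 ∂M.condForwardLaw x₀ ≤
      ∫⁻ z, ENNReal.ofReal (-M.weightX (k + 1)) *
        negLog (ENNReal.ofReal (M.predProb (k + 1) (at_ z (k + 1)) x₀)) ∂M.condForwardLaw x₀ := by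
  rw [M.lintegral_unmaskCost hx₀ h1 hk ((M.measurable_maskedCost (k + 1) x₀).const_mul _)
    fun _ _ => rfl]
  exact lintegral_mono fun z => mul_le_mul_right (M.maskedCost_le _ _ _) _

lemma lintegral_unmaskCost_eq (hM : M.CarryOver) (h1 : 1 ≤ k) (hk : k < T) :
    ∫⁻ z, M.unmaskCost k x₀ (at_ z (k + 1)) (at_ z k).1 ∂M.condForwardLaw x₀ =
      ∫⁻ z, ENNReal.ofReal (-M.weightX (k + 1)) *
        negLog (ENNReal.ofReal (M.predProb (k + 1) (at_ z (k + 1)) x₀)) ∂M.condForwardLaw x₀ :=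
  M.lintegral_unmaskCost hx₀ h1 hk (g := fun w => ENNReal.ofReal (-M.weightX (k + 1)) *
    negLog (ENNReal.ofReal (M.predProb (k + 1) w x₀))) (by fun_prop) fun w hw => by
      rw [M.maskedCost_eq hM (by omega) hk hw]

end

/-! ### The objective -/

/-- The loss of a single path, whose expectation under the forward process is the objective up to
the constant `-d / 2`; keeping that constant apart makes the loss nonnegative. -/
def pathLoss (z : Path S V d T) : ℝ≥0∞ :=
  gaussEnergy (M.yDen 1 (at_ z 1)) (M.sigmaLat ^ 2) (at_ z 0).2 +
    negLog (ENNReal.ofReal (M.xReverse 1 (at_ z 1) (at_ z 0).1)) +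
    gaussEnergy 0 (M.sigmaBarSq T) (M.alphaBar T • (at_ z 0).2) +
    ∑ t ∈ Finset.Icc 2 T,
      (ENNReal.ofReal (M.weightY t * ‖(at_ z 0).2 - M.yDen t (at_ z t)‖ ^ 2) +
        ENNReal.ofReal (-M.weightX t) *
          negLog (ENNReal.ofReal (M.predProb t (at_ z t) (at_ z 0).1)))

lemma lintegral_pathLoss (P : Measure (Path S V d T)) : ∫⁻ z, M.pathLoss z ∂P =
    ∫⁻ z, gaussEnergy (M.yDen 1 (at_ z 1)) (M.sigmaLat ^ 2) (at_ z 0).2 ∂P +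
      ∫⁻ z, negLog (ENNReal.ofReal (M.xReverse 1 (at_ z 1) (at_ z 0).1)) ∂P +
      ∫⁻ z, gaussEnergy 0 (M.sigmaBarSq T) (M.alphaBar T • (at_ z 0).2) ∂P +
      ∑ t ∈ Finset.Icc 2 T,
        (∫⁻ z, ENNReal.ofReal (M.weightY t * ‖(at_ z 0).2 - M.yDen t (at_ z t)‖ ^ 2) ∂P +
          ∫⁻ z, ENNReal.ofReal (-M.weightX t) *
            negLog (ENNReal.ofReal (M.predProb t (at_ z t) (at_ z 0).1)) ∂P) := by
  unfold pathLoss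
  rw [lintegral_add_left (by fun_prop), lintegral_add_left (by fun_prop),
    lintegral_add_left (by fun_prop), lintegral_finsetSum _ fun t _ => by fun_prop]
  congr 1
  exact Finset.sum_congr rfl fun t _ => lintegral_add_left (by fun_prop) _

lemma lossX_eq {t : ℕ} (h1 : 1 ≤ t) (ht : t ≤ T) : M.lossX t =
    ∫⁻ z, ENNReal.ofReal (-M.weightX t) *
      negLog (ENNReal.ofReal (M.predProb t (at_ z t) (at_ z 0).1)) ∂M.forwardLaw := by
  obtain ⟨k, rfl⟩ : ∃ k, t = k + 1 := ⟨t - 1, by omega⟩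
  simp_rw [lossX, toENNReal_mul_log (M.weightX_nonpos ht)]

theorem loss_eq : M.loss =
    ((∫⁻ z, M.pathLoss z ∂M.forwardLaw : ℝ≥0∞) : EReal) - ((d / 2 : ℝ) : EReal) := by
  have hsum : ∑ t ∈ Finset.Icc 2 T, ((M.lossX t : EReal) + (M.lossY t : EReal)) =
      ((∑ t ∈ Finset.Icc 2 T, (M.lossY t + M.lossX t) : ℝ≥0∞) : EReal) := by
    simp_rw [coe_ennreal_sum, EReal.coe_ennreal_add, add_comm]
  have hX : ∑ t ∈ Finset.Icc 2 T, (M.lossY t + M.lossX t) =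
      ∑ t ∈ Finset.Icc 2 T, (M.lossY t + ∫⁻ z, ENNReal.ofReal (-M.weightX t) *
        negLog (ENNReal.ofReal (M.predProb t (at_ z t) (at_ z 0).1)) ∂M.forwardLaw) :=
    Finset.sum_congr rfl fun t ht => by
      rw [Finset.mem_Icc] at ht
      rw [M.lossX_eq (by omega) ht.2]
  rw [loss, lossXT_eq_zero, lossYT_eq, hsum, hX, lintegral_pathLoss, lossZ0]
  simp only [EReal.coe_ennreal_add, EReal.coe_ennreal_zero, zero_add, sub_eq_add_neg]
  rw [← add_assoc, add_right_comm _ (-((d / 2 : ℝ) : EReal))]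
  congr 2
  rw [add_comm, ← add_assoc, add_right_comm]
  rfl

section Masked

variable {x₀ : TokSeq S V} {i : Fin S} (hi : x₀ i = mask V)

include hi

lemma modelProb_eq_zero : M.modelProb x₀ = 0 := by
  have hne : ∀ᵐ z ∂M.modelLaw, (z 0).1 ≠ x₀ := by
    rw [modelLaw_eq, ae_withDensity_iff M.measurable_modelDensity]
    refine ae_of_all _ fun z hz h0 => hz ?_
    have hrev : M.revStep 0 (at_ z 1) (at_ z 0) = 0 := by
      rw [revStep, stateDensity, at_eq z T.succ_pos]
      simp [M.xReverse_eq_zero M.gamBar_zero (at_ z 1) (show (z 0).1 i = mask V from h0 ▸ hi)]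
    rw [modelDensity_eq, hrev, zero_mul, mul_zero]
  simpa [modelProb] using ae_iff.1 hne

lemma klDiv_condForwardLaw_eq_top : klDiv (M.condForwardLaw x₀) M.modelLaw = ∞ := by
  have hle := negLog_measure_le_klDiv (ν := M.modelLaw) (g := fun z : Path S V d T => (z 0).1)
    (by fun_prop) (M.ae_fst_at_zero_eq x₀)
  change negLog (M.modelProb x₀) ≤ _ at hle
  rwa [M.modelProb_eq_zero hi, negLog_zero, top_le_iff] at hle

lemma lintegral_pathLoss_eq_top : ∫⁻ z, M.pathLoss z ∂M.condForwardLaw x₀ = ∞ := by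
  have htop : ∫⁻ z, negLog (ENNReal.ofReal (M.xReverse 1 (at_ z 1) (at_ z 0).1))
      ∂M.condForwardLaw x₀ = ∫⁻ _, ∞ ∂M.condForwardLaw x₀ := by
    refine lintegral_congr_ae ?_
    filter_upwards [M.ae_fst_at_zero_eq x₀] with z hz
    rw [at_eq z T.succ_pos]
    simp [M.xReverse_eq_zero M.gamBar_zero (at_ z 1) (show (z 0).1 i = mask V from hz ▸ hi)]
  simp [lintegral_pathLoss, htop]

end Masked

lemma sum_Icc_two_eq_sum_Ico {R : Type*} [AddCommMonoid R] (φ : ℕ → R) :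
    ∑ t ∈ Finset.Icc 2 T, φ t = ∑ k ∈ Finset.Ico 1 T, φ (k + 1) := by
  rw [Finset.sum_Ico_add' φ 1 T 1]
  rfl

lemma lintegral_predProb (t : ℕ) (x₀ : TokSeq S V) (c : ℝ≥0∞) :
    ∫⁻ z, c * negLog (ENNReal.ofReal (M.predProb t (at_ z t) (at_ z 0).1))
        ∂M.condForwardLaw x₀ =
      ∫⁻ z, c * negLog (ENNReal.ofReal (M.predProb t (at_ z t) x₀)) ∂M.condForwardLaw x₀ := by
  refine lintegral_congr_ae ?_
  filter_upwards [M.ae_fst_at_zero_eq x₀] with z hz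
  rw [at_eq z T.succ_pos]
  exact hz ▸ rfl

theorem klDiv_add_dim_le_lintegral_pathLoss (x₀ : TokSeq S V) :
    klDiv (M.condForwardLaw x₀) M.modelLaw + ENNReal.ofReal (d / 2) ≤
      ∫⁻ z, M.pathLoss z ∂M.condForwardLaw x₀ := by
  by_cases hx₀ : ∀ i, x₀ i ≠ mask V
  · rw [M.klDiv_condForwardLaw_add_dim hx₀, lintegral_pathLoss, sum_Icc_two_eq_sum_Ico]
    refine add_le_add le_rfl (Finset.sum_le_sum fun k hk => add_le_add le_rfl ?_)
    rw [Finset.mem_Ico] at hk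
    rw [lintegral_predProb]
    exact M.lintegral_unmaskCost_le hx₀ hk.1 hk.2
  · push Not at hx₀
    obtain ⟨i, hi⟩ := hx₀
    rw [M.lintegral_pathLoss_eq_top hi]
    exact le_top

theorem klDiv_add_dim_eq_lintegral_pathLoss (hM : M.CarryOver) (x₀ : TokSeq S V) :
    klDiv (M.condForwardLaw x₀) M.modelLaw + ENNReal.ofReal (d / 2) =
      ∫⁻ z, M.pathLoss z ∂M.condForwardLaw x₀ := by
  by_cases hx₀ : ∀ i, x₀ i ≠ mask V
  · rw [M.klDiv_condForwardLaw_add_dim hx₀, lintegral_pathLoss, sum_Icc_two_eq_sum_Ico]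
    congr 1
    refine Finset.sum_congr rfl fun k hk => ?_
    rw [Finset.mem_Ico] at hk
    rw [lintegral_predProb, M.lintegral_unmaskCost_eq hx₀ hM hk.1 hk.2]
  · push Not at hx₀
    obtain ⟨i, hi⟩ := hx₀
    rw [M.lintegral_pathLoss_eq_top hi, M.klDiv_condForwardLaw_eq_top hi, top_add]

/-! ### Averaging over the data -/

lemma sum_data : ∑ x₀, M.data x₀ = 1 := by
  rw [← tsum_fintype (L := .unconditional _)]; exact M.data.tsum_coe

lemma lintegral_forwardLaw (h : Path S V d T → ℝ≥0∞) :
    ∫⁻ z, h z ∂M.forwardLaw = ∑ x₀, M.data x₀ * ∫⁻ z, h z ∂M.condForwardLaw x₀ := by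
  simp [forwardLaw, lintegral_finsetSum_measure, lintegral_smul_measure]

lemma negELBO_add_dim : M.negELBO + ENNReal.ofReal (d / 2) = ∑ x₀, M.data x₀ *
    (klDiv (M.condForwardLaw x₀) M.modelLaw + ENNReal.ofReal (d / 2)) := by
  simp_rw [mul_add, Finset.sum_add_distrib, ← Finset.sum_mul, sum_data, one_mul]
  rfl

theorem negELBO_add_dim_le :
    M.negELBO + ENNReal.ofReal (d / 2) ≤ ∫⁻ z, M.pathLoss z ∂M.forwardLaw := by
  rw [negELBO_add_dim, lintegral_forwardLaw]
  gcongr with x₀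
  exact M.klDiv_add_dim_le_lintegral_pathLoss x₀

theorem negELBO_add_dim_eq (hM : M.CarryOver) :
    M.negELBO + ENNReal.ofReal (d / 2) = ∫⁻ z, M.pathLoss z ∂M.forwardLaw := by
  simp_rw [negELBO_add_dim, lintegral_forwardLaw, M.klDiv_add_dim_eq_lintegral_pathLoss hM]

lemma coe_negELBO : (M.negELBO : EReal) =
    ((M.negELBO + ENNReal.ofReal (d / 2) : ℝ≥0∞) : EReal) - ((d / 2 : ℝ) : EReal) := by
  rw [EReal.coe_ennreal_add, EReal.coe_ennreal_ofReal, max_eq_left (by positivity),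
    EReal.add_sub_cancel_right]

theorem negLogLik_le_negELBO : M.negLogLik ≤ (M.negELBO : EReal) := by
  rw [negELBO, coe_ennreal_sum, negLogLik]
  refine Finset.sum_le_sum fun x₀ _ => ?_
  rw [EReal.coe_ennreal_mul]
  refine mul_le_mul_of_nonneg_left ?_ (EReal.coe_ennreal_nonneg _)
  calc -ENNReal.log (M.modelProb x₀)
      ≤ (negLog (M.modelProb x₀) : EReal) :=
        (le_max_right _ _).trans_eq EReal.coe_toENNReal_eq_max.symm
    _ ≤ (klDiv (M.condForwardLaw x₀) M.modelLaw : EReal) :=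
        EReal.coe_ennreal_le_coe_ennreal_iff.2 <|
          negLog_measure_le_klDiv (g := fun z : Path S V d T => (z 0).1) (by fun_prop)
            (M.ae_fst_at_zero_eq x₀)

end Model

end FujiLDDM

end

theorem proposition3 {S V d T : ℕ} (M : FujiLDDM.Model S V d T) :
    M.negLogLik ≤ (M.negELBO : EReal) ∧
    (M.negELBO : EReal) ≤ M.loss ∧
    (M.CarryOver → (M.negELBO : EReal) = M.loss) := by
  refine ⟨M.negLogLik_le_negELBO, ?_, fun hM => ?_⟩
  · rw [M.coe_negELBO, M.loss_eq]
    exact EReal.sub_le_sub (EReal.coe_ennreal_le_coe_ennreal_iff.2 M.negELBO_add_dim_le) le_rfl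
  · rw [M.coe_negELBO, M.loss_eq, M.negELBO_add_dim_eq hM]
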